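/- **Setting.** Let $\Omega\subset\mathbb R^2$ be a polygonal region crossed by a fracture $\Gamma$, a simple polygonal arc whose two end points are its only vertices on $\partial\Omega$, such that $\Omega_B=\Omega\setminus\bar\Gamma$ is the disjoint union of two open sets $\Omega_{B,1},\Omega_{B,2}$ lying on the two sides of $\Gamma$. Let $n_\Gamma$ be the unit normal of $\Gamma$ that is outward for $\Omega_{B,1}$. For traces $q_1,q_2$ from the two sides of an edge with unit normal $n$ pointing from side 1 to side 2, write $[q]=q_1-q_2$, $\{q\}=\frac12(q_1+q_2)$, $[v\cdot n]=v_1\cdot n-v_2\cdot n$, $\{v\cdot n\}=\frac12(v_1\cdot n+v_2\cdot n)$; on $\Gamma$, side $i$ is $\Omega_{B,i}$ and $n=n_\Gamma$. *Data.* $K:\Omega_B\to\mathbb R^{2\times2}$ is measurable (for example piecewise constant), symmetric and uniformly elliptic, $0<K_1\le K(x)z\cdot z\le K_2$ for $|z|=1$; $f\in L^2(\Omega_B)$, $f_\Gamma\in L^2(\Gamma)$; $\kappa_\Gamma^*,\kappa_\Gamma^n,\ell_\Gamma>0$ are piecewise constant on $\Gamma$; $\xi\in(\frac12,1]$; $K_\Gamma=\kappa_\Gamma^*\ell_\Gamma$,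 $\eta_\Gamma=\ell_\Gamma/\kappa_\Gamma^n$, $\alpha_\Gamma=\eta_\Gamma(\frac\xi2-\frac14)$. *Exact solution.* $p\in H^1(\Omega_B)$, $u\in L^2(\Omega_B)^2$ and $p_\Gamma\in H^1_0(\Gamma)$ satisfy, in the weak sense, $u+K\nabla p=0$ and $\nabla\cdot u=f$ in $\Omega_B$, $p=0$ on $\partial\Omega\setminus\bar\Gamma$, $-\nabla_t\cdot(K_\Gamma\nabla_tp_\Gamma)=\ell_\Gamma f_\Gamma+[u\cdot n_\Gamma]$ on $\Gamma$, and $\eta_\Gamma\{u\cdot n_\Gamma\}=[p]$, $\alpha_\Gamma[u\cdot n_\Gamma]=\{p\}-p_\Gamma$ on $\Gamma$. It is assumed that $u$ has normal traces in $L^2(\partial\tau)$ on each triangle $\tau$ of the mesh below (as is the case if $u\in H^\delta(\Omega_B)^2$ for some $\delta>\frac12$). *Mesh.* Let $\mathcal T_u$ be a mesh of $\Omega$ by polygons, none of which is cut by $\Gamma$. Each polygon $S(\nu)$ is divided into triangles by connecting an interior point $\nu$ to all its vertices, and the resulting triangulation $\mathcal T_h$ is conforming. $\mathcal F_u^0$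 is the set of sides of polygons that lie neither on $\partial\Omega$ nor on $\Gamma$, $\mathcal F_u$ the set of all sides not on $\Gamma$, $\mathcal F_h^\Gamma$ the set of sides on $\Gamma$, which form a mesh of $\Gamma$, and $\mathcal F_p$ the set of edges of $\mathcal T_h$ that contain a point $\nu$. The coefficients $\kappa_\Gamma^*,\kappa_\Gamma^n,\ell_\Gamma$ are constant on each $e\in\mathcal F_h^\Gamma$. *Assumption (A)* with constant $\rho_S>0$: every $S(\nu)\in\mathcal T_u$ is star-shaped with respect to a ball of radius at least $\rho_S$ times its diameter. *Discrete spaces*, for $k\ge0$: $S_h$ is the set of $q$ with $q|_\tau\in P^k(\tau)$ for all $\tau\in\mathcal T_h$, $[q]|_e=0$ for all $e\in\mathcal F_u^0$ and $q=0$ on $\partial\Omega\setminus\bar\Gamma$; $V_h$ is the set of $v$ with $v|_\tau\in P^k(\tau)^2$ for all $\tau$ and $[v\cdot n]|_e=0$ for all $e\in\mathcal F_p$; $W_h$ is the set of $q\in H^1_0(\Gamma)$ with $q|_e\in P^k(e)$ for all $e\in\mathcal F_h^\Gamma$. *Scheme.* $(u_h,p_h,p_{\Gamma,h})\in V_h\times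 S_h\times W_h$ satisfies, for all $(v,q,q_\Gamma)\in V_h\times S_h\times W_h$, $$(K^{-1}u_h,v)_{\Omega_B}+b_h^*(p_h,v)=0,$$ $$-b_h(u_h,q)+\sum_{e\in\mathcal F_h^\Gamma}\langle\tfrac1{\alpha_\Gamma}(\{p_h\}-p_{\Gamma,h}),\{q\}\rangle_e+\sum_{e\in\mathcal F_h^\Gamma}\langle\tfrac1{\eta_\Gamma}[p_h],[q]\rangle_e=(f,q)_{\Omega_B},$$ $$\langle K_\Gamma\nabla_tp_{\Gamma,h},\nabla_tq_\Gamma\rangle_\Gamma-\sum_{e\in\mathcal F_h^\Gamma}\langle\tfrac1{\alpha_\Gamma}(\{p_h\}-p_{\Gamma,h}),q_\Gamma\rangle_e=\langle\ell_\Gamma f_\Gamma,q_\Gamma\rangle_\Gamma,$$ where $$b_h(v,q)=-\sum_{e\in\mathcal F_p}\langle v\cdot n,[q]\rangle_e+\sum_{\tau\in\mathcal T_h}(v,\nabla q)_\tau,$$ $$b_h^*(q,v)=\sum_{e\in\mathcal F_u^0}\langle q,[v\cdot n]\rangle_e-\sum_{\tau\in\mathcal T_h}(q,\nabla\cdot v)_\tau+\sum_{e\in\mathcal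 F_h^\Gamma}\big(\langle[q],\{v\cdot n\}\rangle_e+\langle\{q\},[v\cdot n]\rangle_e\big).$$ *Projections.* $I_hp\in S_h$ is given by $\langle I_hp-p,\psi\rangle_e=0$ for all $\psi\in P^k(e)$, $e\in\mathcal F_u$, the same from each of the two sides for $e\in\mathcal F_h^\Gamma$, and $(I_hp-p,\psi)_\tau=0$ for all $\psi\in P^{k-1}(\tau)$, $\tau\in\mathcal T_h$; $J_hu\in V_h$ by $\langle(J_hu-u)\cdot n,\psi\rangle_e=0$ for all $\psi\in P^k(e)$, $e\in\mathcal F_p$, and $(J_hu-u,\psi)_\tau=0$ for all $\psi\in P^{k-1}(\tau)^2$, $\tau\in\mathcal T_h$ (with $P^{-1}=\{0\}$); the Ritz projection $\Pi_h^pp_\Gamma\in W_h$ by $\langle K_\Gamma\nabla_t\Pi_h^pp_\Gamma,\nabla_tq\rangle_\Gamma=\langle K_\Gamma\nabla_tp_\Gamma,\nabla_tq\rangle_\Gamma$ for all $q\in W_h$. **Theorem.** For every $\rho_S>0$ there is a constant $C>0$, depending on nothing but $\rho_S$ (in particular not on the mesh, on $h$, or on the problem data), such that, under Assumption (A) with constant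 $\rho_S$, $$\begin{aligned}&\|K^{-\frac12}(J_hu-u_h)\|_{0,\Omega_B}+\|K_\Gamma^{\frac12}\nabla_t(\Pi_h^pp_\Gamma-p_{\Gamma,h})\|_{0,\Gamma}+\Big(\sum_{e\in\mathcal F_h^\Gamma}\|\eta_\Gamma^{-\frac12}[I_hp-p_h]\|_{0,e}^2\Big)^{\frac12}\\&\quad+\Big(\sum_{e\in\mathcal F_h^\Gamma}\|\alpha_\Gamma^{-\frac12}(\{I_hp-p_h\}-(\Pi_h^pp_\Gamma-p_{\Gamma,h}))\|_{0,e}^2\Big)^{\frac12}\\&\le C\Big(\|K^{-\frac12}(u-J_hu)\|_{0,\Omega_B}^2+\|\alpha_\Gamma^{-\frac12}(p_\Gamma-\Pi_h^pp_\Gamma)\|_{0,\Gamma}^2\Big)^{\frac12}.\end{aligned}$$ -/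

import Mathlib

open scoped ContDiff
open MeasureTheory

noncomputable section

/-! # Plane geometry and integrals over segments -/

/-- The Euclidean plane. -/
abbrev Plane := EuclideanSpace ℝ (Fin 2)

/-- The two-dimensional cross product. -/
def cross (a b : Plane) : ℝ := a 0 * b 1 - a 1 * b 0

/-- The unit normal of the oriented segment from `a` to `b` that points to the right-hand side.
For an edge of a counterclockwise polygon it is the outward unit normal. -/
def unitNormal (a b : Plane) : Plane := (dist a b)⁻¹ • !₂[b 1 - a 1, a 0 - b 0]

/-- The point with affine parameter `t` on the segment from `a` to `b`. -/
def segPt (a b : Plane) (t : ℝ) : Plane := AffineMap.lineMap a b t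

/-- The integral of `g` over the segment `[a, b]` with respect to arc length. -/
def segInt (a b : Plane) (g : Plane → ℝ) : ℝ :=
  dist a b * ∫ t in (0 : ℝ)..1, g (segPt a b t)

/-- `g` is square integrable on the segment `[a, b]`. -/
def SegL2 (a b : Plane) (g : Plane → ℝ) : Prop :=
  MemLp (fun t => g (segPt a b t)) 2 (volume.restrict (Set.Icc (0 : ℝ) 1))

/-- `P x` holds for almost every point `x` of the segment `[a, b]`. -/
def SegAE (a b : Plane) (P : Plane → Prop) : Prop :=
  ∀ᵐ t ∂(volume.restrict (Set.Icc (0 : ℝ) 1)), P (segPt a b t)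

/-- A matrix applied to a vector of the plane. -/
def mulVecP (A : Matrix (Fin 2) (Fin 2) ℝ) (v : Plane) : Plane := WithLp.toLp 2 (A.mulVec v.ofLp)

/-! # Polynomials in two variables -/

/-- Real polynomials in two variables. -/
abbrev Poly2 := MvPolynomial (Fin 2) ℝ

/-- The value of a polynomial at a point. -/
def pval (q : Poly2) (x : Plane) : ℝ := MvPolynomial.eval x.ofLp q

/-- The value of the gradient of a polynomial at a point. -/
def pgrad (q : Poly2) (x : Plane) : Plane :=
  WithLp.toLp 2 fun i => MvPolynomial.eval x.ofLp (MvPolynomial.pderiv i q)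

/-- The value of a polynomial vector field at a point. -/
def vval (v : Fin 2 → Poly2) (x : Plane) : Plane :=
  WithLp.toLp 2 fun i => MvPolynomial.eval x.ofLp (v i)

/-- The divergence of a polynomial vector field at a point. -/
def vdiv (v : Fin 2 → Poly2) (x : Plane) : ℝ :=
  ∑ i, MvPolynomial.eval x.ofLp (MvPolynomial.pderiv i (v i))

/-! # Polygonal meshes and their triangular submeshes -/

/-- A finite family of polygons. The polygon `T` has `extra T + 3` vertices `vtx T j`, listed
counterclockwise with cyclic index `j`, and an interior point `center T`. Connecting `center T`
to all the vertices splits the polygon into the triangles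
`(vtx T j, vtx T (j + 1), center T)`; together they form a conforming triangulation.
Vertices with a straight angle (hanging nodes) and arbitrarily short sides are allowed. -/
structure PolygonMesh where
  nElem : ℕ
  extra : Fin nElem → ℕ
  vtx : (T : Fin nElem) → Fin (extra T + 3) → Plane
  center : Fin nElem → Plane
  ccw : ∀ T j, 0 < cross (vtx T j - center T) (vtx T (j + 1) - center T)

namespace PolygonMesh

variable (M : PolygonMesh)

/-- Index of the triangles: the triangle `⟨T, j⟩` is the one over the `j`-th side of `T`, so that
the same index also stands for the sides of the polygons. -/
abbrev Tri := (T : Fin M.nElem) × Fin (M.extra T + 3)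

/-- The corners of a triangle, counterclockwise. The edges are `corner s i, corner s (i + 1)`:
edge `0` is the side of the polygon, edges `1` and `2` contain the interior point. -/
def corner (s : M.Tri) : Fin 3 → Plane :=
  ![M.vtx s.1 s.2, M.vtx s.1 (s.2 + 1), M.center s.1]

/-- The closed triangle. -/
def tri (s : M.Tri) : Set Plane := convexHull ℝ (Set.range (M.corner s))

/-- The closed polygon. -/
def elem (T : Fin M.nElem) : Set Plane := ⋃ j, M.tri ⟨T, j⟩

/-- The next triangle, counterclockwise, in the same polygon. It shares with `s` the edge from
`corner s 1` to `center`. These edges, one for each `s`, are the edges in `F_p`. -/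
def next (s : M.Tri) : M.Tri := ⟨s.1, s.2 + 1⟩

/-- Outward unit normal of a triangle on its `i`-th edge. -/
def normal (s : M.Tri) (i : Fin 3) : Plane := unitNormal (M.corner s i) (M.corner s (i + 1))

/-- Integral over the `i`-th edge of a triangle. -/
def edgeInt (s : M.Tri) (i : Fin 3) (g : Plane → ℝ) : ℝ :=
  segInt (M.corner s i) (M.corner s (i + 1)) g

/-- Every polygon is star-shaped with respect to all the points of a ball whose radius is at
least `ρ` times the diameter of the polygon. -/
def StarRegular (ρ : ℝ) : Prop :=
  ∀ T, ∃ (c : Plane) (r : ℝ), ρ * Metric.diam (M.elem T) ≤ r ∧ Metric.ball c r ⊆ M.elem T ∧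
    ∀ y ∈ Metric.ball c r, StarConvex ℝ y (M.elem T)

end PolygonMesh

/-- A polygonal mesh of a polygonal region that is crossed by a fracture, to which the mesh is
aligned. The fracture is a polygonal arc with consecutive mesh vertices `γ 0, …, γ nF`; the
segments `[γ i, γ (i + 1)]` form the fracture mesh. The sides of the polygons are sorted into
the two sides of each interior primal edge off the fracture (`intSide e 0`, `intSide e 1`),
the two sides of each fracture edge (`fracSide i 0` in `Ω₁`, `fracSide i 1` in `Ω₂`), and the
sides on the outer boundary (`bdSide`). -/
structure FracturedMesh extends PolygonMesh where
  /-- the triangles do not overlap -/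
  disj : ∀ s s' : toPolygonMesh.Tri, s ≠ s' →
    Disjoint (interior (toPolygonMesh.tri s)) (interior (toPolygonMesh.tri s'))
  /-- two triangles meet in a common corner, in a common edge or not at all -/
  conforming : ∀ s s' : toPolygonMesh.Tri, s ≠ s' →
    toPolygonMesh.tri s ∩ toPolygonMesh.tri s' ⊆
      convexHull ℝ (Set.range (toPolygonMesh.corner s) ∩ Set.range (toPolygonMesh.corner s'))
  nI : ℕ
  nF : ℕ
  nB : ℕ
  intSide : Fin nI → Fin 2 → toPolygonMesh.Tri
  fracSide : Fin nF → Fin 2 → toPolygonMesh.Tri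
  bdSide : Fin nB → toPolygonMesh.Tri
  /-- every side of a polygon occurs exactly once in the list -/
  side_bij : Function.Bijective
    (Sum.elim (fun x : Fin nI × Fin 2 => intSide x.1 x.2)
      (Sum.elim (fun x : Fin nF × Fin 2 => fracSide x.1 x.2) bdSide))
  /-- the two sides of an interior edge are the same segment, with opposite orientations -/
  int_match : ∀ e, toPolygonMesh.corner (intSide e 0) 0 = toPolygonMesh.corner (intSide e 1) 1 ∧
    toPolygonMesh.corner (intSide e 0) 1 = toPolygonMesh.corner (intSide e 1) 0
  /-- the vertices of the fracture mesh -/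
  γ : Fin (nF + 1) → Plane
  nF_pos : 0 < nF
  γ_inj : Function.Injective γ
  frac_match₁ : ∀ i, toPolygonMesh.corner (fracSide i 0) 0 = γ i.castSucc ∧
    toPolygonMesh.corner (fracSide i 0) 1 = γ i.succ
  frac_match₂ : ∀ i, toPolygonMesh.corner (fracSide i 1) 0 = γ i.succ ∧
    toPolygonMesh.corner (fracSide i 1) 1 = γ i.castSucc
  /-- the region, the closed fracture and the two parts of the bulk region -/
  Ω : Set Plane
  Γ : Set Plane
  Ω₁ : Set Plane
  Ω₂ : Set Plane
  Ω_eq : Ω = interior (⋃ T, toPolygonMesh.elem T)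
  Γ_eq : Γ = ⋃ i : Fin nF, segment ℝ (γ i.castSucc) (γ i.succ)
  isOpen₁ : IsOpen Ω₁
  isOpen₂ : IsOpen Ω₂
  disj₁₂ : Disjoint Ω₁ Ω₂
  bulk_eq : Ω \ Γ = Ω₁ ∪ Ω₂
  /-- the fracture crosses the region: its end points, and no other vertices of it, lie on the
  boundary of the region -/
  γ_frontier : ∀ i, γ i ∈ frontier Ω ↔ i = 0 ∨ i = Fin.last nF
  /-- no element is cut by the fracture: it belongs to one of the two subdomains -/
  elem_side : ∀ T, interior (toPolygonMesh.elem T) ⊆ Ω₁ ∨ interior (toPolygonMesh.elem T) ⊆ Ω₂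
  /-- `Ω₁` and `Ω₂` lie on the two sides of the fracture -/
  frac_side₁ : ∀ i, interior (toPolygonMesh.tri (fracSide i 0)) ⊆ Ω₁
  frac_side₂ : ∀ i, interior (toPolygonMesh.tri (fracSide i 1)) ⊆ Ω₂
  /-- interior edges lie in the bulk region, the remaining ones on its outer boundary -/
  int_sub : ∀ e, openSegment ℝ (toPolygonMesh.corner (intSide e 0) 0)
    (toPolygonMesh.corner (intSide e 0) 1) ⊆ Ω \ Γ
  bd_sub : ∀ b, segment ℝ (toPolygonMesh.corner (bdSide b) 0)
    (toPolygonMesh.corner (bdSide b) 1) ⊆ frontier Ω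

namespace FracturedMesh

variable (M : FracturedMesh)

/-- Index of the triangles. -/
abbrev Tri := M.toPolygonMesh.Tri

/-- The bulk region `Ω \ Γ`. -/
def bulk : Set Plane := M.Ω \ M.Γ

/-- The normal vector of the fracture on its `i`-th edge, outward for `Ω₁`. -/
def nΓ (i : Fin M.nF) : Plane := M.normal (M.fracSide i 0) 0

/-- Integral over the `i`-th edge of the fracture mesh. -/
def fracInt (i : Fin M.nF) (g : Plane → ℝ) : ℝ := segInt (M.γ i.castSucc) (M.γ i.succ) g

/-- Smooth functions with compact support in the bulk region. -/
def IsTest (φ : Plane → ℝ) : Prop :=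
  ContDiff ℝ ∞ φ ∧ HasCompactSupport φ ∧ tsupport φ ⊆ M.bulk

/-- `q` belongs to `H¹` of the bulk region and has the weak gradient `G`. -/
def IsH1 (q : Plane → ℝ) (G : Plane → Plane) : Prop :=
  MemLp q 2 (volume.restrict M.bulk) ∧ MemLp G 2 (volume.restrict M.bulk) ∧
  ∀ φ, M.IsTest φ → ∀ d : Plane,
    ∫ x in M.bulk, q x * fderiv ℝ φ x d = - ∫ x in M.bulk, inner ℝ (G x) d * φ x

/-- `v` belongs to `H(div)` of the bulk region and has the weak divergence `f`. -/
def IsHdiv (v : Plane → Plane) (f : Plane → ℝ) : Prop :=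
  MemLp v 2 (volume.restrict M.bulk) ∧ MemLp f 2 (volume.restrict M.bulk) ∧
  ∀ φ, M.IsTest φ → ∫ x in M.bulk, fderiv ℝ φ x (v x) = - ∫ x in M.bulk, f x * φ x

/-- `t s i` is the trace, from inside the triangle `s`, on the `i`-th edge of `s`, of the `H¹`
function `q` with gradient `G`: the function in `L²` of the boundary of `s` that is determined by
Green's formula. -/
def IsTrace (q : Plane → ℝ) (G : Plane → Plane) (t : M.Tri → Fin 3 → Plane → ℝ) : Prop :=
  (∀ s i, SegL2 (M.corner s i) (M.corner s (i + 1)) (t s i)) ∧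
  ∀ s, ∀ φ : Plane → ℝ, ContDiff ℝ ∞ φ → ∀ d : Plane,
    ∫ x in M.tri s, (inner ℝ (G x) d * φ x + q x * fderiv ℝ φ x d) =
      ∑ i, M.edgeInt s i fun x => t s i x * φ x * inner ℝ d (M.normal s i)

/-- `t s i` is the outward normal trace, from inside the triangle `s`, on the `i`-th edge of `s`,
of the vector field `v` with divergence `f`: the function in `L²` of the boundary of `s` that is
determined by Green's formula. -/
def IsNormalTrace (v : Plane → Plane) (f : Plane → ℝ) (t : M.Tri → Fin 3 → Plane → ℝ) : Prop :=
  (∀ s i, SegL2 (M.corner s i) (M.corner s (i + 1)) (t s i)) ∧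
  ∀ s, ∀ φ : Plane → ℝ, ContDiff ℝ ∞ φ →
    ∫ x in M.tri s, (fderiv ℝ φ x (v x) + f x * φ x) =
      ∑ i, M.edgeInt s i fun x => t s i x * φ x

/-- The space `H¹₀(Γ)`: functions (`val`) on the fracture that are absolutely continuous along it
with square integrable tangential derivative (`der`, with respect to arc length) and vanish at
both end points. Values off the fracture are irrelevant. -/
structure H10 where
  val : Plane → ℝ
  der : Plane → ℝ
  der_L2 : ∀ i : Fin M.nF, SegL2 (M.γ i.castSucc) (M.γ i.succ) der
  ac : ∀ i : Fin M.nF, ∀ t ∈ Set.Icc (0 : ℝ) 1,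
    val (segPt (M.γ i.castSucc) (M.γ i.succ) t) = val (M.γ i.castSucc) +
      dist (M.γ i.castSucc) (M.γ i.succ) *
        ∫ r in (0 : ℝ)..t, der (segPt (M.γ i.castSucc) (M.γ i.succ) r)
  val_first : val (M.γ 0) = 0
  val_last : val (M.γ (Fin.last M.nF)) = 0

/-! ## Problem data and exact solution -/

/-- The data of the problem. The permeability tensor `K` of the bulk is symmetric and uniformly
elliptic. The tangential and normal permeabilities `κt`, `κn` and the thickness `ℓ` of the
fracture are positive and constant on each edge of the fracture mesh. -/
structure Data where
  K : Plane → Matrix (Fin 2) (Fin 2) ℝ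
  K₁ : ℝ
  K₂ : ℝ
  K₁_pos : 0 < K₁
  K_meas : ∀ i j, Measurable fun x => K x i j
  K_symm : ∀ᵐ x ∂(volume.restrict M.bulk), (K x).IsSymm
  K_ell : ∀ᵐ x ∂(volume.restrict M.bulk), ∀ z : Plane, ‖z‖ = 1 →
    K₁ ≤ inner ℝ (mulVecP (K x) z) z ∧ inner ℝ (mulVecP (K x) z) z ≤ K₂
  κt : Fin M.nF → ℝ
  κn : Fin M.nF → ℝ
  ℓ : Fin M.nF → ℝ
  κt_pos : ∀ i, 0 < κt i
  κn_pos : ∀ i, 0 < κn i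
  ℓ_pos : ∀ i, 0 < ℓ i
  ξ : ℝ
  ξ_gt : 1 / 2 < ξ
  ξ_le : ξ ≤ 1
  f : Plane → ℝ
  f_L2 : MemLp f 2 (volume.restrict M.bulk)
  fΓ : Plane → ℝ
  fΓ_L2 : ∀ i : Fin M.nF, SegL2 (M.γ i.castSucc) (M.γ i.succ) fΓ

variable {M}

/-- `K_Γ = κ_Γ^* ℓ_Γ`. -/
def Data.KΓ (D : M.Data) (i : Fin M.nF) : ℝ := D.κt i * D.ℓ i

/-- `η_Γ = ℓ_Γ / κ_Γ^n`. -/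
def Data.η (D : M.Data) (i : Fin M.nF) : ℝ := D.ℓ i / D.κn i

/-- `α_Γ = η_Γ (ξ / 2 - 1 / 4)`. -/
def Data.α (D : M.Data) (i : Fin M.nF) : ℝ := D.η i * (D.ξ / 2 - 1 / 4)

/-- The squared weighted norm `‖K^{-1/2} w‖²` over the bulk region, that is, the integral of
`K⁻¹ w ⬝ w`, of a vector field given triangle by triangle. -/
def Data.KinvNormSq (D : M.Data) (w : M.Tri → Plane → Plane) : ℝ :=
  ∑ s : M.Tri, ∫ x in M.tri s, inner ℝ (mulVecP (D.K x)⁻¹ (w s x)) (w s x)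

/-- A solution of the coupled problem with homogeneous Dirichlet conditions, together with the
traces of `p` and the normal traces of `u` on the edges of the triangles. -/
structure Solution (D : M.Data) where
  p : Plane → ℝ
  gradp : Plane → Plane
  u : Plane → Plane
  pΓ : M.H10
  trp : M.Tri → Fin 3 → Plane → ℝ
  tru : M.Tri → Fin 3 → Plane → ℝ
  p_H1 : M.IsH1 p gradp
  /-- `u + K ∇p = 0` in the bulk region -/
  darcy : ∀ᵐ x ∂(volume.restrict M.bulk), u x + mulVecP (D.K x) (gradp x) = 0
  /-- `div u = f` in the bulk region -/
  mass : M.IsHdiv u D.f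
  trp_spec : M.IsTrace p gradp trp
  tru_spec : M.IsNormalTrace u D.f tru
  /-- `p = 0` on the outer boundary -/
  bc : ∀ b, SegAE (M.corner (M.bdSide b) 0) (M.corner (M.bdSide b) 1)
    fun x => trp (M.bdSide b) 0 x = 0
  /-- `η {u ⬝ n} = [p]` on the fracture; the normal of the fracture is outward for `Ω₁` and inward
  for `Ω₂`, hence the sign of the second trace -/
  interface₁ : ∀ i : Fin M.nF, SegAE (M.γ i.castSucc) (M.γ i.succ) fun x =>
    D.η i * ((tru (M.fracSide i 0) 0 x + -tru (M.fracSide i 1) 0 x) / 2) =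
      trp (M.fracSide i 0) 0 x - trp (M.fracSide i 1) 0 x
  /-- `α [u ⬝ n] = {p} - p_Γ` on the fracture -/
  interface₂ : ∀ i : Fin M.nF, SegAE (M.γ i.castSucc) (M.γ i.succ) fun x =>
    D.α i * (tru (M.fracSide i 0) 0 x - -tru (M.fracSide i 1) 0 x) =
      (trp (M.fracSide i 0) 0 x + trp (M.fracSide i 1) 0 x) / 2 - pΓ.val x
  /-- `- ∇_t (K_Γ ∇_t p_Γ) = ℓ f_Γ + [u ⬝ n]` on the fracture, in weak form -/
  fracture : ∀ q : M.H10,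
    ∑ i, M.fracInt i (fun x => D.KΓ i * pΓ.der x * q.der x) =
      ∑ i, M.fracInt i fun x =>
        (D.ℓ i * D.fΓ x + (tru (M.fracSide i 0) 0 x - -tru (M.fracSide i 1) 0 x)) * q.val x

/-! ## Discrete spaces -/

variable (M)

/-- Piecewise polynomial scalar functions on the triangulation. -/
abbrev PScalar := M.Tri → Poly2

/-- Piecewise polynomial vector fields on the triangulation. -/
abbrev PVector := M.Tri → Fin 2 → Poly2

/-- The space `S_h`: degree at most `k`, continuous over the interior primal edges off the fracture,
zero on the outer boundary. -/
def Sh (k : ℕ) : Set M.PScalar :=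
  {q | (∀ s, (q s).totalDegree ≤ k) ∧
    (∀ e, ∀ x ∈ segment ℝ (M.corner (M.intSide e 0) 0) (M.corner (M.intSide e 0) 1),
      pval (q (M.intSide e 0)) x - pval (q (M.intSide e 1)) x = 0) ∧
    ∀ b, ∀ x ∈ segment ℝ (M.corner (M.bdSide b) 0) (M.corner (M.bdSide b) 1),
      pval (q (M.bdSide b)) x = 0}

/-- The space `V_h`: degree at most `k`, continuous normal component over the edges in `F_p`. -/
def Vh (k : ℕ) : Set M.PVector :=
  {v | (∀ s i, (v s i).totalDegree ≤ k) ∧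
    ∀ s, ∀ x ∈ segment ℝ (M.corner s 1) (M.corner s 2),
      inner ℝ (vval (v s) x) (M.normal s 1) - inner ℝ (vval (v (M.next s)) x) (M.normal s 1) = 0}

/-- The space `W_h`: the members of `H¹₀(Γ)` that are polynomials of degree at most `k` on each edge
of the fracture mesh. -/
def Wh (k : ℕ) : Set M.H10 :=
  {q | ∀ i : Fin M.nF, ∃ P : Poly2, P.totalDegree ≤ k ∧
    ∀ x ∈ segment ℝ (M.γ i.castSucc) (M.γ i.succ), q.val x = pval P x}

variable {M}

/-- The jump `[q]` on the `i`-th fracture edge. -/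
def jump (q : M.PScalar) (i : Fin M.nF) (x : Plane) : ℝ :=
  pval (q (M.fracSide i 0)) x - pval (q (M.fracSide i 1)) x

/-- The average `{q}` on the `i`-th fracture edge. -/
def avg (q : M.PScalar) (i : Fin M.nF) (x : Plane) : ℝ :=
  (pval (q (M.fracSide i 0)) x + pval (q (M.fracSide i 1)) x) / 2

/-- The jump `[v ⬝ n]` on the `i`-th fracture edge. -/
def jumpN (v : M.PVector) (i : Fin M.nF) (x : Plane) : ℝ :=
  inner ℝ (vval (v (M.fracSide i 0)) x) (M.nΓ i) - inner ℝ (vval (v (M.fracSide i 1)) x) (M.nΓ i)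

/-- The average `{v ⬝ n}` on the `i`-th fracture edge. -/
def avgN (v : M.PVector) (i : Fin M.nF) (x : Plane) : ℝ :=
  (inner ℝ (vval (v (M.fracSide i 0)) x) (M.nΓ i) +
    inner ℝ (vval (v (M.fracSide i 1)) x) (M.nΓ i)) / 2

/-- The form `b_h`. -/
def bh (v : M.PVector) (q : M.PScalar) : ℝ :=
  -(∑ s, M.edgeInt s 1 fun x =>
      inner ℝ (vval (v s) x) (M.normal s 1) * (pval (q s) x - pval (q (M.next s)) x))
    + ∑ s : M.Tri, ∫ x in M.tri s, inner ℝ (vval (v s) x) (pgrad (q s) x)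

/-- The form `b_h^*`. -/
def bhStar (q : M.PScalar) (v : M.PVector) : ℝ :=
  (∑ e, M.edgeInt (M.intSide e 0) 0 fun x => pval (q (M.intSide e 0)) x *
      (inner ℝ (vval (v (M.intSide e 0)) x) (M.normal (M.intSide e 0) 0) -
        inner ℝ (vval (v (M.intSide e 1)) x) (M.normal (M.intSide e 0) 0)))
    - (∑ s : M.Tri, ∫ x in M.tri s, pval (q s) x * vdiv (v s) x)
    + (∑ i, M.fracInt i fun x => jump q i x * avgN v i x)
    + ∑ i, M.fracInt i fun x => avg q i x * jumpN v i x

/-- The staggered discontinuous Galerkin scheme. -/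
structure IsDiscreteSolution (D : M.Data) (k : ℕ) (uh : M.PVector) (ph : M.PScalar)
    (pΓh : M.H10) : Prop where
  uh_mem : uh ∈ M.Vh k
  ph_mem : ph ∈ M.Sh k
  pΓh_mem : pΓh ∈ M.Wh k
  flux : ∀ v ∈ M.Vh k,
    (∑ s : M.Tri, ∫ x in M.tri s, inner ℝ (mulVecP (D.K x)⁻¹ (vval (uh s) x)) (vval (v s) x))
      + bhStar ph v = 0
  pressure : ∀ q ∈ M.Sh k,
    -bh uh q
      + (∑ i, M.fracInt i fun x => (D.α i)⁻¹ * (avg ph i x - pΓh.val x) * avg q i x)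
      + (∑ i, M.fracInt i fun x => (D.η i)⁻¹ * jump ph i x * jump q i x)
      = ∑ s : M.Tri, ∫ x in M.tri s, D.f x * pval (q s) x
  fracture : ∀ q ∈ M.Wh k,
    (∑ i, M.fracInt i fun x => D.KΓ i * pΓh.der x * q.der x)
      - (∑ i, M.fracInt i fun x => (D.α i)⁻¹ * (avg ph i x - pΓh.val x) * q.val x)
      = ∑ i, M.fracInt i fun x => D.ℓ i * D.fΓ x * q.val x

/-! ## Interpolants and Ritz projection -/

/-- `w` is the interpolant `I_h p` in `S_h`. The edge condition is imposed on each side of each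
primal edge and of each fracture edge; the element condition, against polynomials of degree at
most `k - 1`, is void for `k = 0`. -/
def IsInterpI {D : M.Data} (S : Solution D) (k : ℕ) (w : M.PScalar) : Prop :=
  w ∈ M.Sh k ∧
  (∀ s, ∀ ψ : Poly2, ψ.totalDegree ≤ k →
    M.edgeInt s 0 (fun x => (pval (w s) x - S.trp s 0 x) * pval ψ x) = 0) ∧
  ∀ s, ∀ ψ : Poly2, ψ.totalDegree < k →
    ∫ x in M.tri s, (pval (w s) x - S.p x) * pval ψ x = 0

/-- `w` is the interpolant `J_h u` in `V_h`. The edge condition is imposed on each side of each edge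
in `F_p`; the element condition, against polynomials of degree at most `k - 1`, is void for
`k = 0`. -/
def IsInterpJ {D : M.Data} (S : Solution D) (k : ℕ) (w : M.PVector) : Prop :=
  w ∈ M.Vh k ∧
  (∀ s, ∀ i : Fin 3, i ≠ 0 → ∀ ψ : Poly2, ψ.totalDegree ≤ k →
    M.edgeInt s i (fun x => (inner ℝ (vval (w s) x) (M.normal s i) - S.tru s i x) * pval ψ x)
      = 0) ∧
  ∀ s, ∀ ψ : Fin 2 → Poly2, (∀ i, (ψ i).totalDegree < k) →
    ∫ x in M.tri s, inner ℝ (vval (w s) x - S.u x) (vval ψ x) = 0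

/-- `w` is the Ritz projection of `g` on `W_h`. -/
def IsRitz (D : M.Data) (k : ℕ) (g w : M.H10) : Prop :=
  w ∈ M.Wh k ∧ ∀ q ∈ M.Wh k,
    ∑ i, M.fracInt i (fun x => D.KΓ i * w.der x * q.der x) =
      ∑ i, M.fracInt i fun x => D.KΓ i * g.der x * q.der x

end FracturedMesh

end

open scoped ContDiff
open MeasureTheory

noncomputable section

/-! # Integrals over segments -/

/-! The estimate is an energy argument in which the projections are chosen so that almost all
consistency errors vanish. Write `e_u = J_h u - u_h`, `e_p = I_h p - p_h` and `e_Γ = Π p_Γ -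
p_{Γ,h}`.

The exact solution satisfies the three discrete equations with `p` replaced by `I_h p` everywhere
and `u` replaced by `J_h u` inside `b_h`. By Green's formula on each triangle, the moments of `I_h`
and `J_h` match the divergences, gradients and edge polynomials that occur (`IsInterpI.flux_eq`,
`pressure_eq`, `IsInterpI.fracture_eq`). This uses that traces of `p` and normal traces of `u` match
across edges in the bulk, which follows from the weak equations by localised test functions
(`IsTrace.segAE_eq`, `IsNormalTrace.segAE_eq`). On the fracture, the interface conditions turn
normal fluxes into jumps and averages of `p`, and the coefficients are constant on each edge, so
`I_h p` can again replace `p`.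

Subtracting the scheme and testing with `e_u`, `e_p`, `e_Γ`, the forms `b_h(e_u, e_p)` and
`b_h^*(e_p, e_u)` cancel because they are adjoint (`bh_eq_bhStar`): integration by parts brings both
to the same expression on polygon sides. The Ritz projection removes the stiffness error on the
fracture. Two terms remain: `K⁻¹(u - J_h u)` against `e_u`, and `α⁻¹(p_Γ - Π p_Γ)` against `{e_p} -
e_Γ`. Young's inequality absorbs both (`energy_le`), and the four square roots are added at the cost
of the factor 2. -/

/-- The restriction of the Lebesgue measure to the unit interval. -/
abbrev unitMeasure : Measure ℝ := volume.restrict (Set.Icc (0 : ℝ) 1)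

/-- `g` is integrable on the segment `[a, b]`. -/
def SegIntegrable (a b : Plane) (g : Plane → ℝ) : Prop :=
  Integrable (fun t => g (segPt a b t)) unitMeasure

section Segments

variable {a b : Plane} {f g : Plane → ℝ}

lemma segInt_eq (a b : Plane) (g : Plane → ℝ) :
    segInt a b g = dist a b * ∫ t, g (segPt a b t) ∂unitMeasure := by
  rw [segInt, intervalIntegral.integral_of_le zero_le_one, integral_Icc_eq_integral_Ioc]

lemma segPt_comm (a b : Plane) (t : ℝ) : segPt b a t = segPt a b (1 - t) :=
  (AffineMap.lineMap_apply_one_sub a b t).symm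

lemma segInt_comm (a b : Plane) (g : Plane → ℝ) : segInt b a g = segInt a b g := by
  simp only [segInt, segPt_comm a b, dist_comm b a]
  rw [intervalIntegral.integral_comp_sub_left (fun t => g (segPt a b t)) 1]
  norm_num

lemma measurePreserving_one_sub_unitMeasure :
    MeasurePreserving (fun t : ℝ => 1 - t) unitMeasure unitMeasure := by
  have h := (Measure.measurePreserving_sub_left (volume : Measure ℝ) 1).restrict_preimage
    (s := Set.Icc 0 1) measurableSet_Icc
  have h2 : (fun t : ℝ => 1 - t) ⁻¹' Set.Icc 0 1 = Set.Icc 0 1 := by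
    ext t; simp only [Set.mem_preimage, Set.mem_Icc]; constructor <;> rintro ⟨h1, h2⟩ <;>
      constructor <;> linarith
  rwa [h2] at h

/-- Neighbouring triangles run through their common edge in opposite directions, so a trace given
for one orientation has to be read in the other. -/
lemma SegL2.comm (h : SegL2 a b g) : SegL2 b a g := by
  have := h.comp_measurePreserving measurePreserving_one_sub_unitMeasure
  simp only [SegL2, segPt_comm a b]
  exact this

lemma continuous_segPt (a b : Plane) : Continuous (segPt a b) := by
  unfold segPt; exact AffineMap.lineMap_continuous

lemma segPt_mem_segment {t : ℝ} (ht : t ∈ Set.Icc (0 : ℝ) 1) : segPt a b t ∈ segment ℝ a b := by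
  rw [segment_eq_image_lineMap]; exact ⟨t, ht, rfl⟩

lemma SegAE.of_forall_mem {P : Plane → Prop} (h : ∀ x ∈ segment ℝ a b, P x) : SegAE a b P :=
  (ae_restrict_iff' measurableSet_Icc).2 (.of_forall fun _ ht => h _ (segPt_mem_segment ht))

lemma SegAE.and {P Q : Plane → Prop} (hP : SegAE a b P) (hQ : SegAE a b Q) :
    SegAE a b fun x => P x ∧ Q x :=
  Filter.Eventually.and hP hQ

lemma SegAE.mono {P Q : Plane → Prop} (h : ∀ x, P x → Q x) (hP : SegAE a b P) : SegAE a b Q :=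
  Filter.Eventually.mono hP fun _ => h _

lemma SegL2.of_continuousOn (h : ContinuousOn (fun t => g (segPt a b t)) (Set.Icc 0 1)) :
    SegL2 a b g := by
  obtain ⟨C, hC⟩ := isCompact_Icc.exists_bound_of_continuousOn h
  refine MemLp.of_bound (h.aestronglyMeasurable measurableSet_Icc) C ?_
  exact (ae_restrict_iff' measurableSet_Icc).2 (.of_forall hC)

lemma SegL2.of_continuous (h : Continuous g) : SegL2 a b g :=
  .of_continuousOn (h.comp (continuous_segPt a b)).continuousOn

lemma SegL2.add (hf : SegL2 a b f) (hg : SegL2 a b g) : SegL2 a b fun x => f x + g x :=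
  MemLp.add hf hg

lemma SegL2.sub (hf : SegL2 a b f) (hg : SegL2 a b g) : SegL2 a b fun x => f x - g x :=
  MemLp.sub hf hg

lemma SegL2.const_mul (hf : SegL2 a b f) (c : ℝ) : SegL2 a b fun x => c * f x :=
  MemLp.const_mul hf c

lemma SegL2.mul (hf : SegL2 a b f) (hg : SegL2 a b g) : SegIntegrable a b fun x => f x * g x :=
  MemLp.integrable_mul hf hg

lemma SegL2.sq (hf : SegL2 a b f) : SegIntegrable a b fun x => f x ^ 2 := by
  simp only [pow_two]; exact hf.mul hf

lemma SegIntegrable.add (hf : SegIntegrable a b f) (hg : SegIntegrable a b g) :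
    SegIntegrable a b fun x => f x + g x := Integrable.add hf hg

lemma SegIntegrable.sub (hf : SegIntegrable a b f) (hg : SegIntegrable a b g) :
    SegIntegrable a b fun x => f x - g x := Integrable.sub hf hg

lemma SegIntegrable.const_mul (hf : SegIntegrable a b f) (c : ℝ) :
    SegIntegrable a b fun x => c * f x := Integrable.const_mul hf c

lemma SegIntegrable.of_continuous (h : Continuous g) : SegIntegrable a b g := by
  simpa using (SegL2.of_continuous h).mul (SegL2.of_continuous (continuous_const (y := (1 : ℝ))))

lemma segInt_congr_ae (h : SegAE a b fun x => f x = g x) : segInt a b f = segInt a b g := by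
  rw [segInt_eq, segInt_eq, integral_congr_ae h]

lemma segInt_congr (h : ∀ x ∈ segment ℝ a b, f x = g x) : segInt a b f = segInt a b g :=
  segInt_congr_ae (.of_forall_mem h)

lemma segInt_add (hf : SegIntegrable a b f) (hg : SegIntegrable a b g) :
    segInt a b (fun x => f x + g x) = segInt a b f + segInt a b g := by
  rw [segInt_eq, segInt_eq, segInt_eq, integral_add hf hg, mul_add]

lemma segInt_sub (hf : SegIntegrable a b f) (hg : SegIntegrable a b g) :
    segInt a b (fun x => f x - g x) = segInt a b f - segInt a b g := by
  rw [segInt_eq, segInt_eq, segInt_eq, integral_sub hf hg, mul_sub]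

lemma segInt_const_mul (c : ℝ) (g : Plane → ℝ) :
    segInt a b (fun x => c * g x) = c * segInt a b g := by
  rw [segInt_eq, segInt_eq, integral_const_mul]; ring

lemma segInt_neg (g : Plane → ℝ) : segInt a b (fun x => -g x) = -segInt a b g := by
  rw [segInt_eq, segInt_eq, integral_neg]; ring

lemma segInt_mono (hf : SegIntegrable a b f) (hg : SegIntegrable a b g) (h : ∀ x, f x ≤ g x) :
    segInt a b f ≤ segInt a b g := by
  rw [segInt_eq, segInt_eq]
  exact mul_le_mul_of_nonneg_left (integral_mono hf hg fun t => h _) dist_nonneg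

lemma segInt_nonneg (h : ∀ x, 0 ≤ f x) : 0 ≤ segInt a b f := by
  rw [segInt_eq]
  exact mul_nonneg dist_nonneg (integral_nonneg fun t => h _)

end Segments

/-! # Polynomials in two variables -/

section Polynomials

open MvPolynomial

lemma pval_add (p q : Poly2) (x : Plane) : pval (p + q) x = pval p x + pval q x := by simp [pval]

lemma pval_sub (p q : Poly2) (x : Plane) : pval (p - q) x = pval p x - pval q x := by simp [pval]

lemma vval_sub (v w : Fin 2 → Poly2) (x : Plane) : vval (v - w) x = vval v x - vval w x := by
  ext i; simp [vval]

lemma pgrad_sub (p q : Poly2) (x : Plane) : pgrad (p - q) x = pgrad p x - pgrad q x := by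
  ext i; simp [pgrad]

lemma vval_apply (v : Fin 2 → Poly2) (x : Plane) (i : Fin 2) : vval v x i = pval (v i) x := rfl

lemma pgrad_eq_vval (q : Poly2) (x : Plane) : pgrad q x = vval (fun i => pderiv i q) x := rfl

lemma contDiff_pval (q : Poly2) : ContDiff ℝ ∞ (pval q) := by
  induction q using MvPolynomial.induction_on with
  | C c => rw [show pval (C c) = fun _ => c from funext fun x => by simp [pval]]
           exact contDiff_const
  | add p q hp hq => rw [show pval (p + q) = fun x => pval p x + pval q x from funext (pval_add p q)]
                     exact hp.add hq
  | mul_X p i hp =>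
    rw [show pval (p * X i) = fun x => pval p x * x i from funext fun x => by simp [pval]]
    exact hp.mul (by fun_prop)

lemma continuous_pval (q : Poly2) : Continuous (pval q) := (contDiff_pval q).continuous

lemma continuous_vval (v : Fin 2 → Poly2) : Continuous (vval v) := by
  unfold vval
  refine (PiLp.continuous_toLp 2 _).comp (continuous_pi fun i => continuous_pval (v i))

lemma continuous_pgrad (q : Poly2) : Continuous (pgrad q) :=
  continuous_vval fun i => pderiv i q

lemma vdiv_eq_pval (v : Fin 2 → Poly2) (x : Plane) : vdiv v x = pval (∑ i, pderiv i (v i)) x := by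
  simp [vdiv, pval]

lemma inner_plane (v w : Plane) : inner ℝ v w = v 0 * w 0 + v 1 * w 1 := by
  simp [PiLp.inner_apply, Fin.sum_univ_two, mul_comm]

lemma pgrad_apply (q : Poly2) (x : Plane) (i : Fin 2) : pgrad q x i = pval (pderiv i q) x := rfl

lemma hasFDerivAt_pval (q : Poly2) (x : Plane) :
    HasFDerivAt (pval q) (innerSL ℝ (pgrad q x)) x := by
  induction q using MvPolynomial.induction_on with
  | C c =>
    have h1 : pval (C c) = fun _ => c := by funext y; simp [pval]
    have h2 : pgrad (C c) x = 0 := by ext i; simp [pgrad]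
    rw [h1, h2, map_zero]; exact hasFDerivAt_const _ _
  | add p q hp hq =>
    have h1 : pval (p + q) = fun x => pval p x + pval q x := funext (pval_add p q)
    have h2 : pgrad (p + q) x = pgrad p x + pgrad q x := by ext i; simp [pgrad]
    rw [h1, h2, map_add]; exact hp.add hq
  | mul_X p i hp =>
    have h1 : pval (p * X i) = fun x => pval p x * x i := funext fun x => by simp [pval]
    rw [h1]
    have hX : HasFDerivAt (fun y : Plane => y i) (EuclideanSpace.proj i : Plane →L[ℝ] ℝ) x :=
      (EuclideanSpace.proj i : Plane →L[ℝ] ℝ).hasFDerivAt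
    refine (hp.fun_mul hX).congr_fderiv ?_
    refine ContinuousLinearMap.ext fun d => ?_
    simp only [innerSL_apply_apply, inner_plane, pgrad_apply, add_apply, smul_apply, smul_eq_mul,
      PiLp.proj_apply]
    fin_cases i <;> simp [pval, pderiv_X] <;> ring

lemma fderiv_pval (q : Poly2) (x d : Plane) : fderiv ℝ (pval q) x d = inner ℝ (pgrad q x) d := by
  rw [(hasFDerivAt_pval q x).fderiv, innerSL_apply_apply]

/-- The normal component of a polynomial vector field, as a polynomial. -/
def innerPoly (v : Fin 2 → Poly2) (n : Plane) : Poly2 := v 0 * C (n 0) + v 1 * C (n 1)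

lemma pval_innerPoly (v : Fin 2 → Poly2) (n x : Plane) :
    pval (innerPoly v n) x = inner ℝ (vval v x) n := by
  simp [innerPoly, inner_plane, vval, pval]

/-- The normal is constant along an edge, so a normal component is an admissible test polynomial in
the edge moments of `I_h`. -/
lemma totalDegree_innerPoly_le {v : Fin 2 → Poly2} {k : ℕ} (h : ∀ i, (v i).totalDegree ≤ k)
    (n : Plane) : (innerPoly v n).totalDegree ≤ k := by
  refine (totalDegree_add _ _).trans (max_le ?_ ?_) <;>
  · refine (totalDegree_mul _ _).trans ?_
    simpa using h _

/-- The zero polynomial has total degree `0`, so "degree below `k`" is empty for `k = 0`. The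
alternative `= 0` expresses the convention that there the space of degree `k - 1` is `{0}`. -/
lemma pderiv_eq_zero_or_totalDegree_lt {q : Poly2} {k : ℕ} (h : q.totalDegree ≤ k) (i : Fin 2) :
    pderiv i q = 0 ∨ (pderiv i q).totalDegree < k := by
  rcases Nat.eq_zero_or_pos k with rfl | hk
  · left
    rw [totalDegree_eq_zero_iff_eq_C.1 (Nat.le_zero.1 h), pderiv_C]
  · right
    rw [q.as_sum, map_sum]
    refine (totalDegree_finsetSum_le (d := k - 1) fun m hm => ?_).trans_lt (by omega)
    rw [pderiv_monomial]
    by_cases hi : m i = 0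
    · simp [hi]
    refine (totalDegree_monomial_le _ _).trans ?_
    have h1 := (le_totalDegree hm).trans h
    -- Truncated subtraction is harmless because `m i ≥ 1`; the two exponent sums differ by exactly
    -- one.
    have h2 : (m - Finsupp.single i 1) + Finsupp.single i 1 = m :=
      tsub_add_cancel_of_le (Finsupp.single_le_iff.2 (Nat.one_le_iff_ne_zero.2 hi))
    have h3 := congrArg (fun m => Finsupp.sum m fun _ e => e) h2
    rw [Finsupp.sum_add_index' (by simp) (by simp), Finsupp.sum_single_index rfl] at h3
    simp only [Finsupp.sum, Function.id_def] at *
    omega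

lemma totalDegree_pderiv_lt {q : Poly2} {k : ℕ} (h : q.totalDegree ≤ k) (hk : k ≠ 0)
    (i : Fin 2) : (pderiv i q).totalDegree < k := by
  rcases pderiv_eq_zero_or_totalDegree_lt h i with h | h
  · rw [h, totalDegree_zero]; omega
  · exact h

end Polynomials

/-! # Green's formula on a triangle -/

section Triangle

/-- The reference triangle. -/
def refTriangle : Set (ℝ × ℝ) := {z | 0 ≤ z.1 ∧ 0 ≤ z.2 ∧ z.1 + z.2 ≤ 1}

/-- The affine map from the reference triangle to the triangle with corners `a`, `b`, `c`. -/
def triMap (a b c : Plane) (z : ℝ × ℝ) : Plane := a + (z.1 • (b - a) + z.2 • (c - a))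

lemma continuous_triMap (a b c : Plane) : Continuous (triMap a b c) := by
  unfold triMap; fun_prop

lemma isClosed_refTriangle : IsClosed refTriangle :=
  (isClosed_le continuous_const continuous_fst).inter
    ((isClosed_le continuous_const continuous_snd).inter
      (isClosed_le (continuous_fst.add continuous_snd) continuous_const))

lemma isCompact_refTriangle : IsCompact refTriangle := by
  refine ((isCompact_Icc (a := (0 : ℝ)) (b := 1)).prod
    (isCompact_Icc (a := (0 : ℝ)) (b := 1))).of_isClosed_subset isClosed_refTriangle ?_
  rintro z ⟨h1, h2, h3⟩
  exact ⟨⟨h1, by linarith⟩, ⟨h2, by linarith⟩⟩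

lemma convex_refTriangle : Convex ℝ refTriangle := by
  rintro x ⟨x1, x2, x3⟩ y ⟨y1, y2, y3⟩ s t hs ht hst
  refine ⟨?_, ?_, ?_⟩ <;>
    simp only [Prod.fst_add, Prod.smul_fst, Prod.snd_add, Prod.smul_snd, smul_eq_mul]
  · positivity
  · positivity
  · nlinarith

/-- In one direction `(1 - z.1 - z.2, z.1, z.2)` are barycentric coordinates; in the other, the
affine image of a convex set is convex and contains the corners. -/
lemma image_triMap (a b c : Plane) :
    triMap a b c '' refTriangle = convexHull ℝ {a, b, c} := by
  apply subset_antisymm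
  · rintro _ ⟨z, ⟨h1, h2, h3⟩, rfl⟩
    have h : triMap a b c z = (1 - z.1 - z.2) • a + z.1 • b + z.2 • c := by
      simp only [triMap]; module
    rw [h]
    have ha : a ∈ convexHull ℝ {a, b, c} := subset_convexHull _ _ (by simp)
    have hb : b ∈ convexHull ℝ {a, b, c} := subset_convexHull _ _ (by simp)
    have hc : c ∈ convexHull ℝ {a, b, c} := subset_convexHull _ _ (by simp)
    have := (convex_convexHull ℝ {a, b, c}).sum_mem (t := (Finset.univ : Finset (Fin 3)))
      (w := ![1 - z.1 - z.2, z.1, z.2]) (z := ![a, b, c])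
      (by intro i _; fin_cases i <;> simp <;> linarith)
      (by simp [Fin.sum_univ_three]; ring)
      (by intro i _; fin_cases i <;> simp [ha, hb, hc])
    simpa [Fin.sum_univ_three] using this
  · refine convexHull_min ?_ ?_
    · rintro x (rfl | rfl | rfl)
      · exact ⟨(0, 0), by simp [refTriangle], by simp [triMap]⟩
      · exact ⟨(1, 0), by simp [refTriangle], by simp [triMap]⟩
      · exact ⟨(0, 1), by simp [refTriangle], by simp [triMap]⟩
    · rintro _ ⟨x, hx, rfl⟩ _ ⟨y, hy, rfl⟩ s t hs ht hst
      refine ⟨s • x + t • y, convex_refTriangle hx hy hs ht hst, ?_⟩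
      simp only [triMap, Prod.fst_add, Prod.smul_fst, Prod.snd_add, Prod.smul_snd, smul_eq_mul]
      have : a = s • a + t • a := by rw [← add_smul, hst, one_smul]
      nth_rewrite 1 [this]
      module

/-- The coordinates of the plane. -/
def planeEquiv : Plane ≃ᵐ ℝ × ℝ :=
  (MeasurableEquiv.toLp 2 (Fin 2 → ℝ)).symm.trans MeasurableEquiv.finTwoArrow

lemma planeEquiv_apply (x : Plane) : planeEquiv x = (x 0, x 1) := rfl

lemma measurePreserving_planeEquiv : MeasurePreserving planeEquiv volume volume :=
  (volume_preserving_finTwoArrow ℝ).comp (PiLp.volume_preserving_ofLp (Fin 2))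

/-- Integrals over a triangle are transformed to the reference triangle. -/
lemma integral_triangle {a b c : Plane} (h : 0 < cross (b - a) (c - a)) (f : Plane → ℝ) :
    ∫ x in convexHull ℝ {a, b, c}, f x =
      cross (b - a) (c - a) * ∫ z in refTriangle, f (triMap a b c z) := by
  set A : Matrix (Fin 2) (Fin 2) ℝ := !![(b - a) 0, (c - a) 0; (b - a) 1, (c - a) 1] with hA
  set L : ℝ × ℝ →L[ℝ] ℝ × ℝ :=
    LinearMap.toContinuousLinearMap (Matrix.toLin (Module.Basis.finTwoProd ℝ)
      (Module.Basis.finTwoProd ℝ) A) with hL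
  have hLapp : ∀ z, planeEquiv (triMap a b c z) = planeEquiv a + L z := by
    intro z
    simp only [hL, hA, LinearMap.coe_toContinuousLinearMap', Matrix.toLin_finTwoProd_apply,
      planeEquiv_apply, triMap]
    ext <;> simp <;> ring
  have hdet : L.det = cross (b - a) (c - a) := by
    rw [hL, LinearMap.det_toContinuousLinearMap, LinearMap.det_toLin, hA, Matrix.det_fin_two_of,
      cross]
    ring
  have hinj : Function.Injective L := by
    have : IsUnit (LinearMap.det (L : ℝ × ℝ →ₗ[ℝ] ℝ × ℝ)) := by
      change IsUnit L.det
      rw [hdet]; exact isUnit_iff_ne_zero.2 h.ne'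
    exact ((LinearMap.isUnit_iff_isUnit_det _).2 this |> (Module.End.isUnit_iff _).1).1
  -- The change of variables is done in `ℝ × ℝ`, where the determinant of the linear part is
  -- explicit, and carried back to the plane by the measure-preserving coordinates.
  have key := integral_image_eq_integral_abs_det_fderiv_smul (volume : Measure (ℝ × ℝ))
    (s := refTriangle) (f := fun z => planeEquiv a + L z) (f' := fun _ => L)
    isClosed_refTriangle.measurableSet
    (fun z _ => (L.hasFDerivWithinAt.const_add _))
    (fun x _ y _ hxy => hinj (add_left_cancel hxy)) (fun z => f (planeEquiv.symm z))
  have himg : (fun z => planeEquiv a + L z) '' refTriangle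
      = planeEquiv.symm ⁻¹' (convexHull ℝ {a, b, c}) := by
    rw [← image_triMap, ← MeasurableEquiv.image_eq_preimage_symm, Set.image_image]
    exact Set.image_congr fun z _ => (hLapp z).symm
  rw [himg, measurePreserving_planeEquiv.symm.setIntegral_preimage_emb
    planeEquiv.symm.measurableEmbedding] at key
  rw [key, hdet, abs_of_pos h]
  simp only [smul_eq_mul]
  rw [integral_const_mul]
  congr 2
  ext z
  rw [← hLapp, MeasurableEquiv.symm_apply_apply]

/-- Fubini for the extension by zero. The first coordinate is the inner variable, so that a
derivative along the first edge can be integrated directly. -/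
lemma integral_refTriangle {H : ℝ × ℝ → ℝ} (hH : Continuous H) :
    ∫ z in refTriangle, H z = ∫ y in (0 : ℝ)..1, ∫ x in (0 : ℝ)..(1 - y), H (x, y) := by
  have hint : Integrable (refTriangle.indicator H) (volume.prod volume) :=
    (integrable_indicator_iff isClosed_refTriangle.measurableSet).2
      (hH.continuousOn.integrableOn_compact isCompact_refTriangle)
  rw [← integral_indicator isClosed_refTriangle.measurableSet, Measure.volume_eq_prod,
    integral_prod_symm _ hint, intervalIntegral.integral_of_le zero_le_one,
    ← integral_Icc_eq_integral_Ioc, ← integral_indicator measurableSet_Icc]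
  congr 1
  ext y
  by_cases hy : y ∈ Set.Icc (0 : ℝ) 1
  · rw [Set.indicator_of_mem hy, intervalIntegral.integral_of_le (by linarith [hy.2]),
      ← integral_Icc_eq_integral_Ioc, ← integral_indicator measurableSet_Icc]
    congr 1
    ext x
    by_cases hx : x ∈ Set.Icc (0 : ℝ) (1 - y)
    · rw [Set.indicator_of_mem hx, Set.indicator_of_mem]
      exact ⟨hx.1, hy.1, by simp only; linarith [hx.2]⟩
    · rw [Set.indicator_of_notMem hx, Set.indicator_of_notMem]
      exact fun h => hx ⟨h.1, by have := h.2.2; simp only at this; linarith⟩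
  · rw [Set.indicator_of_notMem hy]
    refine integral_eq_zero_of_ae (.of_forall fun x => Set.indicator_of_notMem ?_ _)
    exact fun h => hy ⟨h.2.1, by have := h.1; have := h.2.2; simp only at *; linarith⟩

/-- Integral over the derivative in the direction of an edge. -/
lemma integral_triangle_fderiv_edge {a b c : Plane} (h : 0 < cross (b - a) (c - a))
    {F : Plane → ℝ} (hF : ContDiff ℝ 1 F) :
    ∫ x in convexHull ℝ {a, b, c}, fderiv ℝ F x (b - a) =
      cross (b - a) (c - a) * ((∫ t in (0 : ℝ)..1, F (segPt b c t)) -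
        ∫ t in (0 : ℝ)..1, F (segPt a c t)) := by
  have hF' : Continuous fun x => fderiv ℝ F x (b - a) :=
    (hF.continuous_fderiv one_ne_zero).clm_apply continuous_const
  have hcont : Continuous fun z => fderiv ℝ F (triMap a b c z) (b - a) :=
    hF'.comp (continuous_triMap a b c)
  have hseg : ∀ a b : Plane, IntervalIntegrable (fun t => F (segPt a b t)) volume 0 1 :=
    fun a b => (hF.continuous.comp (continuous_segPt a b)).intervalIntegrable _ _
  rw [integral_triangle h, integral_refTriangle hcont, ← intervalIntegral.integral_sub (hseg b c) (hseg a c)]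
  congr 2
  ext y
  have hderiv : ∀ x : ℝ, HasDerivAt (fun x => F (triMap a b c (x, y)))
      (fderiv ℝ F (triMap a b c (x, y)) (b - a)) x := by
    intro x
    have h1 : HasDerivAt (fun x : ℝ => triMap a b c (x, y)) (b - a) x := by
      simp only [triMap]
      have := (((hasDerivAt_id x).smul_const (b - a)).add_const (y • (c - a))).const_add a
      simpa using this
    exact ((hF.differentiable one_ne_zero _).hasFDerivAt.comp_hasDerivAt x h1)
  -- For fixed `y` the inner interval ends on two edges: `x = 1 - y` is the point of `[b, c]` with
  -- parameter `y`, and `x = 0` that of `[a, c]`.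
  rw [intervalIntegral.integral_eq_sub_of_hasDerivAt (fun x _ => hderiv x)
    ((hcont.comp (by fun_prop : Continuous fun x : ℝ => (x, y))).intervalIntegrable _ _)]
  congr 2
  · simp only [triMap, segPt, AffineMap.lineMap_apply_module]; module
  · simp only [triMap, segPt, AffineMap.lineMap_apply_module]; module

/-- Integral over a directional derivative, in terms of integrals over the three edges. -/
lemma integral_triangle_fderiv {a b c : Plane} (h : 0 < cross (b - a) (c - a))
    {F : Plane → ℝ} (hF : ContDiff ℝ 1 F) (d : Plane) :
    ∫ x in convexHull ℝ {a, b, c}, fderiv ℝ F x d =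
      cross d (b - a) * (∫ t in (0 : ℝ)..1, F (segPt a b t)) +
      cross d (c - b) * (∫ t in (0 : ℝ)..1, F (segPt b c t)) +
      cross d (a - c) * ∫ t in (0 : ℝ)..1, F (segPt c a t) := by
  have hrev : ∀ a c : Plane,
      ∫ t in (0 : ℝ)..1, F (segPt c a t) = ∫ t in (0 : ℝ)..1, F (segPt a c t) := by
    intro a c
    simp only [segPt_comm a c]
    rw [intervalIntegral.integral_comp_sub_left (fun t => F (segPt a c t)) 1]
    norm_num
  -- A cyclic relabelling of the corners keeps the orientation, so the formula along `b - a` also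
  -- serves along `c - b`.
  have hcyc : cross (c - b) (a - b) = cross (b - a) (c - a) := by
    simp only [cross, PiLp.sub_apply]; ring
  have h1 := integral_triangle_fderiv_edge h hF
  have h2 := integral_triangle_fderiv_edge (a := b) (b := c) (c := a) (hcyc ▸ h) hF
  have hset : ({b, c, a} : Set Plane) = {a, b, c} := by
    ext x; simp only [Set.mem_insert_iff, Set.mem_singleton_iff]; tauto
  rw [hset, hcyc] at h2
  -- Cramer's rule in the basis `b - a`, `c - b`.
  have hd : d = (cross d (c - b) / cross (b - a) (c - a)) • (b - a) +
      (cross (b - a) d / cross (b - a) (c - a)) • (c - b) := by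
    have h0 := h.ne'
    ext i
    simp only [PiLp.add_apply, PiLp.smul_apply, smul_eq_mul]
    field_simp
    fin_cases i <;> simp [cross] <;> ring
  have hcomp : IsCompact (convexHull ℝ ({a, b, c} : Set Plane)) :=
    Set.Finite.isCompact_convexHull (𝕜 := ℝ) (Set.toFinite _)
  have hint : ∀ e : Plane, IntegrableOn (fun x => fderiv ℝ F x e) (convexHull ℝ {a, b, c}) :=
    fun e => (((hF.continuous_fderiv one_ne_zero).clm_apply
      continuous_const).continuousOn.integrableOn_compact hcomp)
  conv_lhs => rw [hd]
  simp only [map_add, map_smul, smul_eq_mul]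
  rw [integral_add ((hint _).const_mul _) ((hint _).const_mul _), integral_const_mul,
    integral_const_mul, h1, h2, hrev a c, hrev a b]
  have h0 := h.ne'
  field_simp
  simp only [cross, PiLp.sub_apply]
  ring

lemma dist_mul_inner_unitNormal {a b : Plane} (h : a ≠ b) (d : Plane) :
    dist a b * inner ℝ d (unitNormal a b) = cross d (b - a) := by
  have : dist a b ≠ 0 := dist_ne_zero.2 h
  simp only [unitNormal, inner_smul_right, inner_plane, cross]
  field_simp
  simp
  ring

lemma unitNormal_comm (a b : Plane) : unitNormal b a = -unitNormal a b := by
  rw [unitNormal, unitNormal, dist_comm, ← smul_neg]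
  congr 1
  ext i; fin_cases i <;> simp

lemma segInt_mul_inner_unitNormal {a b : Plane} (h : a ≠ b) (F : Plane → ℝ) (d : Plane) :
    segInt a b (fun x => F x * inner ℝ d (unitNormal a b)) =
      cross d (b - a) * ∫ t in (0 : ℝ)..1, F (segPt a b t) := by
  rw [segInt, intervalIntegral.integral_mul_const, ← dist_mul_inner_unitNormal h d]; ring

lemma ne_of_cross_pos {a b c : Plane} (h : 0 < cross (b - a) (c - a)) : a ≠ b := by
  rintro rfl
  simp [cross] at h

end Triangle

namespace PolygonMesh

variable (M : PolygonMesh)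

lemma range_corner (s : M.Tri) (i : Fin 3) :
    Set.range (M.corner s) = {M.corner s i, M.corner s (i + 1), M.corner s (i + 2)} := by
  ext x
  simp only [Set.mem_range, Fin.exists_fin_succ, Set.mem_insert_iff, Set.mem_singleton_iff]
  fin_cases i <;> simp <;> tauto

lemma tri_eq (s : M.Tri) (i : Fin 3) :
    M.tri s = convexHull ℝ {M.corner s i, M.corner s (i + 1), M.corner s (i + 2)} := by
  rw [tri, M.range_corner s i]

lemma cross_corner_pos (s : M.Tri) (i : Fin 3) :
    0 < cross (M.corner s (i + 1) - M.corner s i) (M.corner s (i + 2) - M.corner s i) := by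
  have h := M.ccw s.1 s.2
  fin_cases i <;> simp [corner, cross] at h ⊢ <;> linarith

lemma corner_ne (s : M.Tri) (i : Fin 3) : M.corner s i ≠ M.corner s (i + 1) :=
  ne_of_cross_pos (M.cross_corner_pos s i)

lemma isCompact_tri (s : M.Tri) : IsCompact (M.tri s) :=
  (Set.finite_range _).isCompact_convexHull (𝕜 := ℝ)

lemma convex_tri (s : M.Tri) : Convex ℝ (M.tri s) := convex_convexHull _ _

lemma measurableSet_tri (s : M.Tri) : MeasurableSet (M.tri s) :=
  (M.isCompact_tri s).isClosed.measurableSet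

/-- Green's formula on a triangle of the mesh. -/
lemma integral_tri_fderiv (s : M.Tri) {F : Plane → ℝ} (hF : ContDiff ℝ 1 F) (d : Plane) :
    ∫ x in M.tri s, fderiv ℝ F x d =
      ∑ i, M.edgeInt s i fun x => F x * inner ℝ d (M.normal s i) := by
  rw [M.tri_eq s 0, integral_triangle_fderiv (M.cross_corner_pos s 0) hF, Fin.sum_univ_three]
  simp only [edgeInt, normal]
  rw [segInt_mul_inner_unitNormal (M.corner_ne s 0), segInt_mul_inner_unitNormal (M.corner_ne s 1),
    segInt_mul_inner_unitNormal (M.corner_ne s 2)]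
  rfl

end PolygonMesh

/-! # Traces on edges shared by two triangles -/

/-- Divided by the cross product of the whole triangle, the three cross products are the barycentric
coordinates of `x`; the witness lists those of `b` and `c`. -/
lemma mem_triangle_of_cross_nonneg {a b c x : Plane} (h : 0 < cross (b - a) (c - a))
    (h1 : 0 ≤ cross (b - a) (x - a)) (h2 : 0 ≤ cross (c - b) (x - b))
    (h3 : 0 ≤ cross (a - c) (x - c)) : x ∈ convexHull ℝ {a, b, c} := by
  rw [← image_triMap]
  refine ⟨(cross (a - c) (x - c) / cross (b - a) (c - a),
    cross (b - a) (x - a) / cross (b - a) (c - a)), ⟨div_nonneg h3 h.le, div_nonneg h1 h.le, ?_⟩, ?_⟩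
  · rw [← add_div, div_le_one h]
    simp only [cross, PiLp.sub_apply] at *
    linarith
  · have h0 := h.ne'
    ext i
    simp only [triMap, PiLp.add_apply, PiLp.smul_apply, smul_eq_mul]
    field_simp
    fin_cases i <;> simp [cross] <;> ring

lemma continuous_cross_left (a b : Plane) : Continuous fun x : Plane => cross a (x - b) := by
  simp only [cross, PiLp.sub_apply]; fun_prop

lemma cross_segPt (a b c d : Plane) (t : ℝ) :
    cross a (segPt b c t - d) = (1 - t) * cross a (b - d) + t * cross a (c - d) := by
  simp only [cross, segPt, AffineMap.lineMap_apply_module, PiLp.sub_apply, PiLp.add_apply,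
    PiLp.smul_apply, smul_eq_mul]
  ring

lemma segment_eq_image_segPt (a b : Plane) : segment ℝ a b = segPt a b '' Set.Icc 0 1 :=
  segment_eq_image_lineMap ℝ a b

lemma openSegment_eq_image_segPt (a b : Plane) :
    openSegment ℝ a b = segPt a b '' Set.Ioo 0 1 :=
  openSegment_eq_image_lineMap ℝ a b

/-- The union of two triangles on opposite sides of a common edge is a neighbourhood of the
relative interior of that edge, and the neighbourhood may be chosen off the other edges. -/
lemma exists_nhds_openSegment {a b c d : Plane} (h : 0 < cross (b - a) (c - a))
    (h' : 0 < cross (a - b) (d - b)) :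
    ∃ V : Set Plane, IsOpen V ∧ openSegment ℝ a b ⊆ V ∧
      V ⊆ convexHull ℝ {a, b, c} ∪ convexHull ℝ {b, a, d} ∧
      Disjoint V (segment ℝ b c) ∧ Disjoint V (segment ℝ c a) ∧
      Disjoint V (segment ℝ a d) ∧ Disjoint V (segment ℝ d b) := by
  -- The neighbourhood is the intersection of the open half-planes cut off by the lines through the
  -- four outer edges. On the open common edge the four cross products are `t` or `1 - t` times a
  -- positive number; on each outer edge its own cross product vanishes.
  refine ⟨{x | 0 < cross (c - b) (x - b)} ∩ {x | 0 < cross (a - c) (x - c)} ∩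
    ({x | 0 < cross (d - a) (x - a)} ∩ {x | 0 < cross (b - d) (x - d)}), ?_, ?_, ?_, ?_, ?_, ?_, ?_⟩
  · exact ((isOpen_lt continuous_const (continuous_cross_left _ _)).inter
      (isOpen_lt continuous_const (continuous_cross_left _ _))).inter
      ((isOpen_lt continuous_const (continuous_cross_left _ _)).inter
      (isOpen_lt continuous_const (continuous_cross_left _ _)))
  · rw [openSegment_eq_image_segPt]
    rintro _ ⟨t, ⟨t0, t1⟩, rfl⟩
    have e1 : cross (c - b) (segPt a b t - b) = (1 - t) * cross (b - a) (c - a) := by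
      rw [cross_segPt]; simp only [cross, PiLp.sub_apply]; ring
    have e2 : cross (a - c) (segPt a b t - c) = t * cross (b - a) (c - a) := by
      rw [cross_segPt]; simp only [cross, PiLp.sub_apply]; ring
    have e3 : cross (d - a) (segPt a b t - a) = t * cross (a - b) (d - b) := by
      rw [cross_segPt]; simp only [cross, PiLp.sub_apply]; ring
    have e4 : cross (b - d) (segPt a b t - d) = (1 - t) * cross (a - b) (d - b) := by
      rw [cross_segPt]; simp only [cross, PiLp.sub_apply]; ring
    have t1' : 0 < 1 - t := by linarith
    simp only [Set.mem_inter_iff, Set.mem_ofPred_eq, e1, e2, e3, e4]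
    exact ⟨⟨by positivity, by positivity⟩, ⟨by positivity, by positivity⟩⟩
  · rintro x ⟨⟨h1, h2⟩, h3, h4⟩
    -- The side of the line through `a` and `b` decides which of the two triangles contains `x`.
    rcases le_total 0 (cross (b - a) (x - a)) with h0 | h0
    · exact .inl (mem_triangle_of_cross_nonneg h h0 h1.le h2.le)
    · refine .inr (mem_triangle_of_cross_nonneg h' ?_ h3.le h4.le)
      simp only [cross, PiLp.sub_apply] at h0 ⊢
      linarith
  · rw [Set.disjoint_left, segment_eq_image_segPt]
    rintro _ ⟨⟨h1, h2⟩, h3, h4⟩ ⟨t, -, rfl⟩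
    rw [Set.mem_ofPred_eq, cross_segPt] at h1
    simp only [cross, PiLp.sub_apply] at h1
    linarith
  · rw [Set.disjoint_left, segment_eq_image_segPt]
    rintro _ ⟨⟨h1, h2⟩, h3, h4⟩ ⟨t, -, rfl⟩
    rw [Set.mem_ofPred_eq, cross_segPt] at h2
    simp only [cross, PiLp.sub_apply] at h2
    linarith
  · rw [Set.disjoint_left, segment_eq_image_segPt]
    rintro _ ⟨⟨h1, h2⟩, h3, h4⟩ ⟨t, -, rfl⟩
    rw [Set.mem_ofPred_eq, cross_segPt] at h3
    simp only [cross, PiLp.sub_apply] at h3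
    linarith
  · rw [Set.disjoint_left, segment_eq_image_segPt]
    rintro _ ⟨⟨h1, h2⟩, h3, h4⟩ ⟨t, -, rfl⟩
    rw [Set.mem_ofPred_eq, cross_segPt] at h4
    simp only [cross, PiLp.sub_apply] at h4
    linarith

/-- A compact set `L` is put between `K` and `U`, and the bump function is supported in the interior
of `L`; its closed support is then compact and still inside `U`. -/
lemma exists_contDiff_one_on_compact {K U : Set Plane} (hK : IsCompact K) (hU : IsOpen U)
    (hKU : K ⊆ U) : ∃ χ : Plane → ℝ, ContDiff ℝ ∞ χ ∧ HasCompactSupport χ ∧ tsupport χ ⊆ U ∧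
      ∀ x ∈ K, χ x = 1 := by
  obtain ⟨L, hL, hKL, hLU⟩ := exists_compact_between hK hU hKU
  obtain ⟨χ, h1, -, h3, h4⟩ := exists_contMDiff_support_eq_eq_one_iff
    (modelWithCornersSelf ℝ Plane) (n := ⊤) isOpen_interior hK.isClosed hKL
  have hsub : Function.support χ ⊆ L := h3 ▸ interior_subset
  exact ⟨χ, h1.contDiff, .of_support_subset_isCompact hL hsub,
    (closure_minimal hsub hL.isClosed).trans hLU, fun x hx => (h4 x).1 hx⟩

/-- The fundamental lemma of the calculus of variations on a segment. -/
lemma segAE_eq_zero_of_segInt_mul_eq_zero {a b : Plane} (hab : a ≠ b) {F : Plane → ℝ}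
    (hF : SegL2 a b F) {U : Set Plane} (hU : IsOpen U) (hsub : openSegment ℝ a b ⊆ U)
    (h : ∀ φ : Plane → ℝ, ContDiff ℝ ∞ φ → HasCompactSupport φ → tsupport φ ⊆ U →
      segInt a b (fun x => F x * φ x) = 0) : SegAE a b fun x => F x = 0 := by
  have key := isOpen_Ioo.ae_eq_zero_of_integral_contDiff_smul_eq_zero (μ := unitMeasure)
    (U := Set.Ioo (0 : ℝ) 1) (f := fun t => F (segPt a b t))
    ((hF.integrable one_le_two).locallyIntegrable.locallyIntegrableOn _) ?_
  · have hIoo : ∀ᵐ t ∂unitMeasure, t ∈ Set.Ioo (0 : ℝ) 1 := by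
      rw [unitMeasure, ← Measure.restrict_congr_set Ioo_ae_eq_Icc]
      exact ae_restrict_mem measurableSet_Ioo
    filter_upwards [key, hIoo] with t h1 h2 using h1 h2
  intro g hg hgc hgs
  -- A one-dimensional test function `g` extends to the plane by composing with the affine
  -- coordinate `τ` along the segment. This extension is constant across the segment, so the cutoff
  -- `χ` is needed for compact support in `U`; it equals `1` wherever `g` matters on the segment.
  obtain ⟨χ, hχ, hχc, hχU, hχ1⟩ := exists_contDiff_one_on_compact
    (hgc.isCompact.image (continuous_segPt a b)) hU
    ((Set.image_mono hgs).trans ((openSegment_eq_image_segPt a b).symm.subset.trans hsub))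
  have hne : inner ℝ (b - a) (b - a) ≠ (0 : ℝ) := by
    rw [inner_self_ne_zero]; exact sub_ne_zero.2 hab.symm
  set τ : Plane → ℝ := fun x => inner ℝ (x - a) (b - a) / inner ℝ (b - a) (b - a) with hτ
  have hτseg : ∀ t, τ (segPt a b t) = t := by
    intro t
    have : segPt a b t - a = t • (b - a) := by
      simp only [segPt, AffineMap.lineMap_apply_module]; module
    rw [hτ]; simp only [this, inner_smul_left]
    field_simp
    simp
  have hτc : ContDiff ℝ ∞ τ :=
    ((contDiff_id.sub contDiff_const).inner ℝ contDiff_const).div_const _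
  have := h (fun x => χ x * g (τ x)) (hχ.mul (hg.comp hτc)) hχc.mul_right
    ((tsupport_mul_subset_left).trans hχU)
  rw [segInt_eq] at this
  have hint := (mul_eq_zero.1 this).resolve_left (dist_ne_zero.2 hab)
  rw [← hint]
  congr 1
  ext t
  rw [hτseg, smul_eq_mul]
  by_cases ht : t ∈ tsupport g
  · rw [hχ1 _ ⟨t, ht, rfl⟩]; ring
  · rw [image_eq_zero_of_notMem_tsupport ht]; ring

/-- In the standard basis the integrand is a sum of products of scalar `L²` functions, so only the
components of `L` have to be controlled. -/
lemma integrable_clm_apply_of_memLp {μ : Measure Plane} {v : Plane → Plane} (hv : MemLp v 2 μ)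
    {L : Plane → Plane →L[ℝ] ℝ} (hL : ∀ d, MemLp (fun x => L x d) 2 μ) :
    Integrable (fun x => L x (v x)) μ := by
  have h : ∀ x, L x (v x) = v x 0 * L x (EuclideanSpace.single 0 1) +
      v x 1 * L x (EuclideanSpace.single 1 1) := by
    intro x
    conv_lhs => rw [show v x = v x 0 • EuclideanSpace.single 0 1 +
      v x 1 • EuclideanSpace.single 1 1 by ext i; fin_cases i <;> simp]
    rw [map_add, map_smul, map_smul, smul_eq_mul, smul_eq_mul]
  simp only [h]
  exact ((hv.eval_piLp 0).integrable_mul (hL _)).add ((hv.eval_piLp 1).integrable_mul (hL _))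

/-- Choosing the normal itself as the direction in Green's formula then gives the boundary term
weight one. -/
lemma inner_unitNormal_self {a b : Plane} (h : a ≠ b) :
    inner ℝ (unitNormal a b) (unitNormal a b) = (1 : ℝ) := by
  have hne := dist_ne_zero.2 h
  have h2 : dist a b ^ 2 = (a 0 - b 0) ^ 2 + (a 1 - b 1) ^ 2 := by
    rw [EuclideanSpace.dist_eq, Real.sq_sqrt (by positivity), Fin.sum_univ_two, Real.dist_eq,
      Real.dist_eq, sq_abs, sq_abs]
  refine mul_left_cancel₀ hne ((dist_mul_inner_unitNormal h _).trans ?_)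
  simp only [unitNormal, cross, PiLp.smul_apply, PiLp.sub_apply, smul_eq_mul]
  field_simp
  rw [h2]
  simp
  ring

namespace FracturedMesh

variable (M : FracturedMesh)

/-! ### Triangles inside the bulk region -/

lemma isOpen_bulk : IsOpen M.bulk := by
  rw [bulk, M.bulk_eq]; exact M.isOpen₁.union M.isOpen₂

lemma tri_subset_elem (s : M.Tri) : M.tri s ⊆ M.elem s.1 := Set.subset_iUnion_of_subset s.2 subset_rfl

lemma interior_elem_subset_bulk (T : Fin M.nElem) : interior (M.elem T) ⊆ M.bulk := by
  rw [bulk, M.bulk_eq]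
  exact (M.elem_side T).elim (fun h => h.trans Set.subset_union_left)
    fun h => h.trans Set.subset_union_right

lemma interior_tri_ae_eq (s : M.Tri) : interior (M.tri s) =ᵐ[volume] M.tri s :=
  interior_ae_eq_of_null_frontier (Convex.addHaar_frontier _ (M.convex_tri s))

/-- A closed triangle may touch `Γ` or the outer boundary, but its frontier is null by convexity,
and its interior lies in the interior of its polygon and hence in the bulk. -/
lemma restrict_tri_le (s : M.Tri) :
    (volume : Measure Plane).restrict (M.tri s) ≤ volume.restrict M.bulk := by
  rw [← Measure.restrict_congr_set (M.interior_tri_ae_eq s)]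
  exact Measure.restrict_mono_set _
    ((interior_mono (M.tri_subset_elem s)).trans (M.interior_elem_subset_bulk _))

lemma aedisjoint_tri {s s' : M.Tri} (h : s ≠ s') : AEDisjoint volume (M.tri s) (M.tri s') :=
  (M.disj s s' h).aedisjoint.congr (M.interior_tri_ae_eq s).symm (M.interior_tri_ae_eq s').symm

instance (s : M.Tri) : IsFiniteMeasure ((volume : Measure Plane).restrict (M.tri s)) :=
  ⟨by simpa using (M.isCompact_tri s).measure_lt_top⟩

lemma memLp_tri {E : Type*} [NormedAddCommGroup E] {f : Plane → E}
    (hf : MemLp f 2 (volume.restrict M.bulk)) (s : M.Tri) :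
    MemLp f 2 (volume.restrict (M.tri s)) :=
  hf.mono_measure (M.restrict_tri_le s)

lemma ae_tri {P : Plane → Prop} (h : ∀ᵐ x ∂(volume.restrict M.bulk), P x) (s : M.Tri) :
    ∀ᵐ x ∂(volume.restrict (M.tri s)), P x :=
  ae_mono (M.restrict_tri_le s) h

lemma memLp_tri_of_continuous {E : Type*} [NormedAddCommGroup E] [SecondCountableTopology E]
    {f : Plane → E} (hf : Continuous f) (s : M.Tri) : MemLp f 2 (volume.restrict (M.tri s)) := by
  obtain ⟨C, hC⟩ := (M.isCompact_tri s).exists_bound_of_continuousOn hf.continuousOn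
  exact MemLp.of_bound hf.aestronglyMeasurable C
    ((ae_restrict_iff' (M.measurableSet_tri s)).2 (.of_forall hC))

/-- An edge off the outer boundary and the fracture, shared by two different triangles. -/
structure SharedEdge (s : M.Tri) (i : Fin 3) (s' : M.Tri) (i' : Fin 3) : Prop where
  ne : s ≠ s'
  fst : M.corner s' i' = M.corner s (i + 1)
  snd : M.corner s' (i' + 1) = M.corner s i
  subset : openSegment ℝ (M.corner s i) (M.corner s (i + 1)) ⊆ M.bulk

variable {M}

/-- A test function supported in `V` sees only the common edge in the Green formulas of both
triangles, which isolates the two traces there. -/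
lemma exists_nhds_edge {s s' : M.Tri} {i i' : Fin 3}
    (h1 : M.corner s' i' = M.corner s (i + 1)) (h2 : M.corner s' (i' + 1) = M.corner s i) :
    ∃ V : Set Plane, IsOpen V ∧ openSegment ℝ (M.corner s i) (M.corner s (i + 1)) ⊆ V ∧
      V ⊆ M.tri s ∪ M.tri s' ∧
      (∀ j, j ≠ i → Disjoint V (segment ℝ (M.corner s j) (M.corner s (j + 1)))) ∧
      ∀ j, j ≠ i' → Disjoint V (segment ℝ (M.corner s' j) (M.corner s' (j + 1))) := by
  have hp := M.cross_corner_pos s i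
  have hp' := M.cross_corner_pos s' i'
  rw [h1, h2] at hp'
  obtain ⟨V, hV, hs, hV2, d1, d2, d3, d4⟩ := exists_nhds_openSegment hp hp'
  have e1 : ∀ i : Fin 3, i + 1 + 1 = i + 2 := by decide
  have e2 : ∀ i : Fin 3, i + 2 + 1 = i := by decide
  have e3 : ∀ i j : Fin 3, j ≠ i → j = i + 1 ∨ j = i + 2 := by decide
  refine ⟨V, hV, hs, ?_, fun j hj => ?_, fun j hj => ?_⟩
  · rwa [M.tri_eq s i, M.tri_eq s' i', h1, h2]
  · rcases e3 i j hj with rfl | rfl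
    · rwa [e1]
    · rwa [e2]
  · rcases e3 i' j hj with rfl | rfl
    · rwa [e1, h2]
    · rwa [e2, h1]

lemma SharedEdge.normal_eq {s s' : M.Tri} {i i' : Fin 3} (h : M.SharedEdge s i s' i') :
    M.normal s' i' = -M.normal s i := by
  rw [PolygonMesh.normal, PolygonMesh.normal, h.fst, h.snd, unitNormal_comm]

lemma SharedEdge.edgeInt_eq {s s' : M.Tri} {i i' : Fin 3} (h : M.SharedEdge s i s' i')
    (g : Plane → ℝ) : M.edgeInt s' i' g = M.edgeInt s i g := by
  rw [PolygonMesh.edgeInt, PolygonMesh.edgeInt, h.fst, h.snd, segInt_comm]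

lemma sum_edgeInt_eq_single {s : M.Tri} {i : Fin 3} {V : Set Plane}
    (hd : ∀ j, j ≠ i → Disjoint V (segment ℝ (M.corner s j) (M.corner s (j + 1))))
    {φ : Plane → ℝ} (hφ : tsupport φ ⊆ V) {g : Fin 3 → Plane → ℝ}
    (hg : ∀ j x, φ x = 0 → g j x = 0) :
    ∑ j, M.edgeInt s j (g j) = M.edgeInt s i (g i) := by
  refine Finset.sum_eq_single i (fun j _ hj => ?_) (by simp)
  have h0 : ∀ x ∈ segment ℝ (M.corner s j) (M.corner s (j + 1)), g j x = 0 := fun x hx =>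
    hg _ _ (image_eq_zero_of_notMem_tsupport fun h => Set.disjoint_left.1 (hd j hj) (hφ h) hx)
  rw [PolygonMesh.edgeInt, segInt_congr (g := fun _ => 0) h0]
  simp [segInt]

/-- The triangles overlap in a null set, and the integrand vanishes off their union and off the
bulk, so both sides are the integral over the whole plane. -/
lemma setIntegral_tri_add {s s' : M.Tri} (h : s ≠ s') {g : Plane → ℝ}
    (hg : Integrable g (volume.restrict M.bulk))
    (h1 : ∀ x, x ∉ M.tri s ∪ M.tri s' → g x = 0) (h2 : ∀ x, x ∉ M.bulk → g x = 0) :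
    (∫ x in M.tri s, g x) + ∫ x in M.tri s', g x = ∫ x in M.bulk, g x := by
  rw [← setIntegral_union₀ (M.aedisjoint_tri h) (M.measurableSet_tri s').nullMeasurableSet
    (hg.mono_measure (M.restrict_tri_le s)) (hg.mono_measure (M.restrict_tri_le s')),
    setIntegral_eq_integral_of_forall_compl_eq_zero h1,
    setIntegral_eq_integral_of_forall_compl_eq_zero h2]

lemma inner_normal_self (s : M.Tri) (i : Fin 3) :
    inner ℝ (M.normal s i) (M.normal s i) = (1 : ℝ) :=
  inner_unitNormal_self (M.corner_ne s i)

/-- The traces of an `H¹` function from the two sides of an edge in the bulk region agree. -/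
lemma IsTrace.segAE_eq {q : Plane → ℝ} {G : Plane → Plane} {t : M.Tri → Fin 3 → Plane → ℝ}
    (hq : M.IsH1 q G) (ht : M.IsTrace q G t) {s s' : M.Tri} {i i' : Fin 3}
    (h : M.SharedEdge s i s' i') :
    SegAE (M.corner s i) (M.corner s (i + 1)) fun x => t s i x = t s' i' x := by
  obtain ⟨V, hV, hsV, hVt, hd, hd'⟩ := exists_nhds_edge h.fst h.snd
  have hL2' : SegL2 (M.corner s i) (M.corner s (i + 1)) (t s' i') := by
    have := (ht.1 s' i').comm; rwa [h.fst, h.snd] at this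
  have key : SegAE (M.corner s i) (M.corner s (i + 1)) fun x => t s i x - t s' i' x = 0 := by
    refine segAE_eq_zero_of_segInt_mul_eq_zero (M.corner_ne s i) ((ht.1 s i).sub hL2')
      (hV.inter M.isOpen_bulk) (Set.subset_inter hsV h.subset) fun φ hφ hφc hφs => ?_
    have hφV := hφs.trans Set.inter_subset_left
    have hφB := hφs.trans Set.inter_subset_right
    -- With this direction the boundary terms on the two sides have weights `1` and `-1`.
    set d := M.normal s i
    have hcφ : MemLp φ 2 (volume.restrict M.bulk) :=
      hφ.continuous.memLp_of_hasCompactSupport hφc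
    have hcd : MemLp (fun x => fderiv ℝ φ x d) 2 (volume.restrict M.bulk) :=
      ((hφ.continuous_fderiv (by simp)).clm_apply continuous_const).memLp_of_hasCompactSupport
        (hφc.fderiv_apply ℝ d)
    have hi1 : Integrable (fun x => inner ℝ (G x) d * φ x) (volume.restrict M.bulk) :=
      (hq.2.1.inner_const d).integrable_mul hcφ
    have hi2 : Integrable (fun x => q x * fderiv ℝ φ x d) (volume.restrict M.bulk) :=
      hq.1.integrable_mul hcd
    have hzero : ∀ x, x ∉ tsupport φ → inner ℝ (G x) d * φ x + q x * fderiv ℝ φ x d = 0 := by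
      intro x hx
      rw [image_eq_zero_of_notMem_tsupport hx, image_eq_zero_of_notMem_tsupport
        fun h => hx (tsupport_fderiv_subset ℝ h)]
      simp
    -- The two Green formulas add up to an integral over the bulk, which is zero by the definition
    -- of the weak gradient; the boundary terms must therefore balance.
    have hsum := setIntegral_tri_add h.ne (hi1.add hi2)
      (fun x hx => hzero x fun h => hx (hVt (hφV h))) (fun x hx => hzero x fun h => hx (hφB h))
    simp only [Pi.add_apply] at hsum
    rw [integral_add hi1 hi2, hq.2.2 φ ⟨hφ, hφc, hφB⟩ d, ht.2 s φ hφ d, ht.2 s' φ hφ d,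
      sum_edgeInt_eq_single hd hφV (fun j x hx => by simp [hx]),
      sum_edgeInt_eq_single hd' hφV (fun j x hx => by simp [hx]),
      h.edgeInt_eq, h.normal_eq] at hsum
    simp only [inner_neg_right, inner_normal_self, mul_neg, mul_one, PolygonMesh.edgeInt,
      segInt_neg, add_neg_cancel, d] at hsum
    have hφ2 : SegL2 (M.corner s i) (M.corner s (i + 1)) φ := .of_continuous hφ.continuous
    simp only [sub_mul]
    rw [segInt_sub ((ht.1 s i).mul hφ2) (hL2'.mul hφ2)]
    linarith
  exact key.mono fun x hx => sub_eq_zero.1 hx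

/-- The outward normal traces of an `H(div)` field from the two sides of an edge in the bulk
region are opposite to each other. -/
lemma IsNormalTrace.segAE_eq {v : Plane → Plane} {f : Plane → ℝ}
    {t : M.Tri → Fin 3 → Plane → ℝ} (hv : M.IsHdiv v f) (ht : M.IsNormalTrace v f t)
    {s s' : M.Tri} {i i' : Fin 3} (h : M.SharedEdge s i s' i') :
    SegAE (M.corner s i) (M.corner s (i + 1)) fun x => t s' i' x = -t s i x := by
  obtain ⟨V, hV, hsV, hVt, hd, hd'⟩ := exists_nhds_edge h.fst h.snd
  have hL2' : SegL2 (M.corner s i) (M.corner s (i + 1)) (t s' i') := by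
    have := (ht.1 s' i').comm; rwa [h.fst, h.snd] at this
  have key : SegAE (M.corner s i) (M.corner s (i + 1)) fun x => t s i x + t s' i' x = 0 := by
    refine segAE_eq_zero_of_segInt_mul_eq_zero (M.corner_ne s i) ((ht.1 s i).add hL2')
      (hV.inter M.isOpen_bulk) (Set.subset_inter hsV h.subset) fun φ hφ hφc hφs => ?_
    have hφV := hφs.trans Set.inter_subset_left
    have hφB := hφs.trans Set.inter_subset_right
    have hcφ : MemLp φ 2 (volume.restrict M.bulk) :=
      hφ.continuous.memLp_of_hasCompactSupport hφc
    have hi1 : Integrable (fun x => fderiv ℝ φ x (v x)) (volume.restrict M.bulk) :=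
      integrable_clm_apply_of_memLp hv.1 fun d =>
        ((hφ.continuous_fderiv (by simp)).clm_apply continuous_const).memLp_of_hasCompactSupport
          (hφc.fderiv_apply ℝ d)
    have hi2 : Integrable (fun x => f x * φ x) (volume.restrict M.bulk) :=
      hv.2.1.integrable_mul hcφ
    have hzero : ∀ x, x ∉ tsupport φ → fderiv ℝ φ x (v x) + f x * φ x = 0 := by
      intro x hx
      have h0 : fderiv ℝ φ x = 0 :=
        image_eq_zero_of_notMem_tsupport fun h => hx (tsupport_fderiv_subset ℝ h)
      rw [image_eq_zero_of_notMem_tsupport hx, h0]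
      simp
    -- As for scalar traces, but the outward normals are already part of the normal traces, so it is
    -- their sum that vanishes.
    have hsum := setIntegral_tri_add h.ne (hi1.add hi2)
      (fun x hx => hzero x fun h => hx (hVt (hφV h))) (fun x hx => hzero x fun h => hx (hφB h))
    simp only [Pi.add_apply] at hsum
    rw [integral_add hi1 hi2, hv.2.2 φ ⟨hφ, hφc, hφB⟩, ht.2 s φ hφ, ht.2 s' φ hφ,
      sum_edgeInt_eq_single hd hφV (fun j x hx => by simp [hx]),
      sum_edgeInt_eq_single hd' hφV (fun j x hx => by simp [hx]),
      h.edgeInt_eq, neg_add_cancel] at hsum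
    have hφ2 : SegL2 (M.corner s i) (M.corner s (i + 1)) φ := .of_continuous hφ.continuous
    simp only [add_mul]
    rw [segInt_add ((ht.1 s i).mul hφ2) (hL2'.mul hφ2)]
    exact hsum
  exact key.mono fun x hx => by linarith

end FracturedMesh

/-! # The discrete forms -/

lemma integrable_inner_of_memLp {μ : Measure Plane} {v w : Plane → Plane} (hv : MemLp v 2 μ)
    (hw : MemLp w 2 μ) : Integrable (fun x => inner ℝ (v x) (w x)) μ := by
  simp only [inner_plane]
  exact ((hv.eval_piLp 0).integrable_mul (hw.eval_piLp 0)).add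
    ((hv.eval_piLp 1).integrable_mul (hw.eval_piLp 1))

namespace FracturedMesh

open MvPolynomial

variable {M : FracturedMesh}

lemma segL2_pval (q : Poly2) (a b : Plane) : SegL2 a b (pval q) :=
  .of_continuous (continuous_pval q)

lemma segL2_inner_vval (v : Fin 2 → Poly2) (n a b : Plane) :
    SegL2 a b fun x => inner ℝ (vval v x) n :=
  .of_continuous ((continuous_vval v).inner continuous_const)

lemma memLp_pval (q : Poly2) (s : M.Tri) : MemLp (pval q) 2 (volume.restrict (M.tri s)) :=
  M.memLp_tri_of_continuous (continuous_pval q) s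

lemma memLp_vval (v : Fin 2 → Poly2) (s : M.Tri) : MemLp (vval v) 2 (volume.restrict (M.tri s)) :=
  M.memLp_tri_of_continuous (continuous_vval v) s

lemma memLp_pgrad (q : Poly2) (s : M.Tri) : MemLp (pgrad q) 2 (volume.restrict (M.tri s)) :=
  M.memLp_tri_of_continuous (continuous_pgrad q) s

lemma memLp_vdiv (v : Fin 2 → Poly2) (s : M.Tri) : MemLp (vdiv v) 2 (volume.restrict (M.tri s)) := by
  rw [show vdiv v = pval (∑ i, pderiv i (v i)) from funext (vdiv_eq_pval v)]
  exact memLp_pval _ s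

/-- Green's formula against constant directions implies Green's formula for polynomial vector
fields. -/
lemma green_vval {s : M.Tri} {q : Plane → ℝ} {G : Plane → Plane} {t : Fin 3 → Plane → ℝ}
    (hq : MemLp q 2 (volume.restrict (M.tri s))) (hG : MemLp G 2 (volume.restrict (M.tri s)))
    (ht : ∀ i, SegL2 (M.corner s i) (M.corner s (i + 1)) (t i))
    (h : ∀ φ : Plane → ℝ, ContDiff ℝ ∞ φ → ∀ d : Plane,
      ∫ x in M.tri s, (inner ℝ (G x) d * φ x + q x * fderiv ℝ φ x d) =
        ∑ i, M.edgeInt s i fun x => t i x * φ x * inner ℝ d (M.normal s i))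
    (v : Fin 2 → Poly2) :
    (∫ x in M.tri s, inner ℝ (vval v x) (G x)) =
      (∑ i, M.edgeInt s i fun x => t i x * inner ℝ (vval v x) (M.normal s i)) -
        ∫ x in M.tri s, q x * vdiv v x := by
  have hfd : ∀ j x, fderiv ℝ (pval (v j)) x (EuclideanSpace.single j 1) =
      pval (pderiv j (v j)) x := by
    intro j x
    rw [fderiv_pval, EuclideanSpace.inner_single_right]
    simp [pgrad_apply]
  have hGj : ∀ j x, inner ℝ (G x) (EuclideanSpace.single j (1 : ℝ)) = G x j := by
    intro j x; rw [EuclideanSpace.inner_single_right]; simp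
  have hint : ∀ j, Integrable (fun x => G x j * pval (v j) x + q x * pval (pderiv j (v j)) x)
      (volume.restrict (M.tri s)) := fun j =>
    ((hG.eval_piLp j).integrable_mul (memLp_pval (v j) s)).add
      (hq.integrable_mul (memLp_pval (pderiv j (v j)) s))
  -- The test function is the component `v j` and the direction the `j`-th basis vector; summing
  -- over `j` produces the divergence and the normal component.
  have key : ∀ j, ∫ x in M.tri s, (G x j * pval (v j) x + q x * pval (pderiv j (v j)) x) =
      ∑ i, M.edgeInt s i fun x => t i x * pval (v j) x * M.normal s i j := by
    intro j
    have := h (pval (v j)) (contDiff_pval _) (EuclideanSpace.single j 1)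
    simpa only [hfd, hGj, EuclideanSpace.inner_single_left, map_one, one_mul] using this
  have hsum := congrArg₂ (· + ·) (key 0) (key 1)
  simp only at hsum
  rw [← integral_add (hint 0) (hint 1), ← Finset.sum_add_distrib] at hsum
  have hqv : Integrable (fun x => q x * vdiv v x) (volume.restrict (M.tri s)) :=
    hq.integrable_mul (memLp_vdiv v s)
  rw [eq_sub_iff_add_eq, ← integral_add (integrable_inner_of_memLp (memLp_vval v s) hG) hqv]
  refine Eq.trans (Eq.trans ?_ hsum) ?_
  · refine integral_congr_ae (.of_forall fun x => ?_)
    simp only [inner_plane, vval_apply, vdiv, Fin.sum_univ_two, pval]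
    ring
  · refine Finset.sum_congr rfl fun i _ => ?_
    rw [PolygonMesh.edgeInt, PolygonMesh.edgeInt, PolygonMesh.edgeInt, ← segInt_add]
    · refine segInt_congr fun x _ => ?_
      simp only [inner_plane, vval_apply]
      ring
    · exact ((ht i).mul (segL2_pval (v 0) _ _)).mul_const _
    · exact ((ht i).mul (segL2_pval (v 1) _ _)).mul_const _

/-- Integration by parts for polynomials on a triangle. -/
lemma integral_inner_vval_pgrad (s : M.Tri) (v : Fin 2 → Poly2) (q : Poly2) :
    (∫ x in M.tri s, inner ℝ (vval v x) (pgrad q x)) =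
      (∑ i, M.edgeInt s i fun x => pval q x * inner ℝ (vval v x) (M.normal s i)) -
        ∫ x in M.tri s, pval q x * vdiv v x := by
  refine green_vval (memLp_pval q s) (memLp_pgrad q s) (fun i => segL2_pval q _ _) ?_ v
  intro φ hφ d
  -- For a polynomial `q` the required formula is the divergence theorem for the product of `q` and
  -- `φ`.
  have h := M.integral_tri_fderiv s (((contDiff_pval q).mul hφ).of_le (by simp)) d
  rw [← h]
  refine integral_congr_ae (.of_forall fun x => ?_)
  simp only
  rw [fderiv_fun_mul ((contDiff_pval q).differentiable (by simp) x)
    (hφ.differentiable (by simp) x)]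
  simp only [add_apply, smul_apply, smul_eq_mul, fderiv_pval]
  ring

/-! ### Shared edges and regrouping of edge sums -/

lemma sharedEdge_next (s : M.Tri) : M.SharedEdge s 1 (M.next s) 2 := by
  have h1 : M.corner (M.next s) 2 = M.corner s (1 + 1) := rfl
  have h2 : M.corner (M.next s) (2 + 1) = M.corner s 1 := rfl
  refine ⟨fun h => ?_, h1, h2, ?_⟩
  · have h3 : (s.2 + 1 : Fin (M.extra s.1 + 3)) = s.2 :=
      eq_of_heq (Sigma.mk.inj_iff.1 h).2.symm
    exact one_ne_zero (add_eq_left.1 h3)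
  -- Both triangles belong to the same polygon, so the open edge lies in the interior of that
  -- polygon, and no element is cut by the fracture.
  · obtain ⟨V, hV, hs, hVt, -⟩ := exists_nhds_edge h1 h2
    refine hs.trans ((interior_maximal (hVt.trans (Set.union_subset (M.tri_subset_elem s) ?_))
      hV).trans (M.interior_elem_subset_bulk s.1))
    exact M.tri_subset_elem (M.next s)

lemma sharedEdge_intSide (e : Fin M.nI) :
    M.SharedEdge (M.intSide e 0) 0 (M.intSide e 1) 0 := by
  refine ⟨fun h => ?_, (M.int_match e).2.symm, (M.int_match e).1.symm, M.int_sub e⟩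
  have := M.side_bij.1 (a₁ := .inl (e, 0)) (a₂ := .inl (e, 1)) h
  simp at this

lemma next_bijective : Function.Bijective M.next := by
  refine Finite.injective_iff_bijective.1 fun s s' h => ?_
  obtain ⟨T, j⟩ := s
  obtain ⟨T', j'⟩ := s'
  obtain rfl : T = T' := congrArg Sigma.fst h
  have h3 : (j + 1 : Fin (M.extra T + 3)) = j' + 1 := eq_of_heq (Sigma.mk.inj_iff.1 h).2
  rw [add_right_cancel h3]

/-- Each edge in `F_p` occurs twice, as edge `1` of `s` and as edge `2` of its successor, and taking
successors permutes the triangles. -/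
lemma sum_edges (E : M.Tri → Fin 3 → ℝ) :
    ∑ s, ∑ i, E s i = ∑ s, E s 0 + ∑ s, (E s 1 + E (M.next s) 2) := by
  have : ∑ s, E (M.next s) 2 = ∑ s, E s 2 := next_bijective.sum_comp fun s => E s 2
  simp only [Fin.sum_univ_three, Finset.sum_add_distrib, this]
  ring

lemma sum_sides (E : M.Tri → ℝ) :
    ∑ s, E s = (∑ e, (E (M.intSide e 0) + E (M.intSide e 1))) +
      ((∑ i, (E (M.fracSide i 0) + E (M.fracSide i 1))) + ∑ b, E (M.bdSide b)) := by
  rw [← M.side_bij.sum_comp E, Fintype.sum_sum_type, Fintype.sum_sum_type,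
    Fintype.sum_prod_type, Fintype.sum_prod_type]
  simp [Fin.sum_univ_two]

lemma edgeInt_fracSide_zero (i : Fin M.nF) (g : Plane → ℝ) :
    M.edgeInt (M.fracSide i 0) 0 g = M.fracInt i g := by
  have h := M.frac_match₁ i
  rw [PolygonMesh.edgeInt, fracInt, h.1, zero_add, h.2]

lemma edgeInt_fracSide_one (i : Fin M.nF) (g : Plane → ℝ) :
    M.edgeInt (M.fracSide i 1) 0 g = M.fracInt i g := by
  have h := M.frac_match₂ i
  rw [PolygonMesh.edgeInt, fracInt, h.1, zero_add, h.2, segInt_comm]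

lemma normal_fracSide_one (i : Fin M.nF) : M.normal (M.fracSide i 1) 0 = -M.nΓ i := by
  have h := M.frac_match₁ i
  have h' := M.frac_match₂ i
  rw [nΓ, PolygonMesh.normal, PolygonMesh.normal, zero_add, h.1, h.2, h'.1, h'.2, unitNormal_comm]

/-! ### Adjointness of the two forms -/

/-- The form `b_h^*` in terms of integrals over the sides of the polygons. -/
lemma bhStar_eq {k : ℕ} {q : M.PScalar} (hq : q ∈ M.Sh k) (v : M.PVector) :
    bhStar q v =
      (∑ s, M.edgeInt s 0 fun x => pval (q s) x * inner ℝ (vval (v s) x) (M.normal s 0)) -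
        ∑ s : M.Tri, ∫ x in M.tri s, pval (q s) x * vdiv (v s) x := by
  have hcont : ∀ (q : Poly2) (v : Fin 2 → Poly2) (n : Plane),
      Continuous fun x => pval q x * inner ℝ (vval v x) n := fun q v n =>
    (continuous_pval q).mul ((continuous_vval v).inner continuous_const)
  rw [sum_sides, bhStar]
  -- On an interior side `q` is single-valued and the outward normals are opposite, so the jump term
  -- splits into the outward contributions of the two triangles.
  have hint : ∀ e, (M.edgeInt (M.intSide e 0) 0 fun x => pval (q (M.intSide e 0)) x *
      (inner ℝ (vval (v (M.intSide e 0)) x) (M.normal (M.intSide e 0) 0) -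
        inner ℝ (vval (v (M.intSide e 1)) x) (M.normal (M.intSide e 0) 0))) =
      (M.edgeInt (M.intSide e 0) 0 fun x => pval (q (M.intSide e 0)) x *
        inner ℝ (vval (v (M.intSide e 0)) x) (M.normal (M.intSide e 0) 0)) +
      M.edgeInt (M.intSide e 1) 0 fun x => pval (q (M.intSide e 1)) x *
        inner ℝ (vval (v (M.intSide e 1)) x) (M.normal (M.intSide e 1) 0) := by
    intro e
    rw [(sharedEdge_intSide e).edgeInt_eq, (sharedEdge_intSide e).normal_eq, PolygonMesh.edgeInt,
      PolygonMesh.edgeInt, PolygonMesh.edgeInt, ← segInt_add (.of_continuous (hcont _ _ _))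
      (.of_continuous (hcont _ _ _))]
    refine segInt_congr fun x hx => ?_
    rw [zero_add] at hx
    rw [← sub_eq_zero.1 (hq.2.1 e x hx), inner_neg_right]
    ring
  -- This is the identity `[q]{v·n} + {q}[v·n] = q₁ v₁·n - q₂ v₂·n`.
  have hfrac : ∀ i, (M.fracInt i fun x => jump q i x * avgN v i x) +
      (M.fracInt i fun x => avg q i x * jumpN v i x) =
      (M.edgeInt (M.fracSide i 0) 0 fun x => pval (q (M.fracSide i 0)) x *
        inner ℝ (vval (v (M.fracSide i 0)) x) (M.normal (M.fracSide i 0) 0)) +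
      M.edgeInt (M.fracSide i 1) 0 fun x => pval (q (M.fracSide i 1)) x *
        inner ℝ (vval (v (M.fracSide i 1)) x) (M.normal (M.fracSide i 1) 0) := by
    intro i
    have hc1 : Continuous (jump q i) := (continuous_pval _).sub (continuous_pval _)
    have hc2 : Continuous (avg q i) := ((continuous_pval _).add (continuous_pval _)).div_const _
    have hv : ∀ s, Continuous fun x => inner ℝ (vval (v s) x) (M.nΓ i) := fun s =>
      (continuous_vval (v s)).inner continuous_const
    have hc3 : Continuous (avgN v i) := ((hv _).add (hv _)).div_const _
    have hc4 : Continuous (jumpN v i) := (hv _).sub (hv _)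
    have h13 : SegIntegrable (M.γ i.castSucc) (M.γ i.succ) fun x => jump q i x * avgN v i x :=
      .of_continuous (hc1.mul hc3)
    have h24 : SegIntegrable (M.γ i.castSucc) (M.γ i.succ) fun x => avg q i x * jumpN v i x :=
      .of_continuous (hc2.mul hc4)
    rw [edgeInt_fracSide_zero, edgeInt_fracSide_one, normal_fracSide_one, fracInt, fracInt,
      fracInt, fracInt, ← segInt_add h13 h24,
      ← segInt_add (.of_continuous (hcont _ _ _)) (.of_continuous (hcont _ _ _))]
    refine segInt_congr fun x _ => ?_
    rw [inner_neg_right]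
    simp only [jump, avg, jumpN, avgN, nΓ]
    ring
  have hbd : ∀ b, (M.edgeInt (M.bdSide b) 0 fun x => pval (q (M.bdSide b)) x *
      inner ℝ (vval (v (M.bdSide b)) x) (M.normal (M.bdSide b) 0)) = 0 := by
    intro b
    rw [PolygonMesh.edgeInt, segInt_congr (g := fun _ => 0)]
    · simp [segInt]
    · intro x hx
      rw [zero_add] at hx
      rw [hq.2.2 b x hx, zero_mul]
  rw [Finset.sum_congr rfl fun e _ => hint e, ← Finset.sum_congr rfl fun i _ => hfrac i,
    Finset.sum_eq_zero fun b _ => hbd b,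
    Finset.sum_add_distrib (f := fun i => M.fracInt i fun x => jump q i x * avgN v i x)]
  ring

/-- The form `b_h` in terms of integrals over the sides of the polygons. -/
lemma bh_eq {k : ℕ} {v : M.PVector} (hv : v ∈ M.Vh k) (q : M.PScalar) :
    bh v q =
      (∑ s, M.edgeInt s 0 fun x => pval (q s) x * inner ℝ (vval (v s) x) (M.normal s 0)) -
        ∑ s : M.Tri, ∫ x in M.tri s, pval (q s) x * vdiv (v s) x := by
  have hcont : ∀ (q : Poly2) (v : Fin 2 → Poly2) (n : Plane),
      Continuous fun x => pval q x * inner ℝ (vval v x) n := fun q v n =>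
    (continuous_pval q).mul ((continuous_vval v).inner continuous_const)
  have hnext : ∀ s, (M.edgeInt s 1 fun x =>
      inner ℝ (vval (v s) x) (M.normal s 1) * (pval (q s) x - pval (q (M.next s)) x)) =
      (M.edgeInt s 1 fun x => pval (q s) x * inner ℝ (vval (v s) x) (M.normal s 1)) +
      M.edgeInt (M.next s) 2 fun x => pval (q (M.next s)) x *
        inner ℝ (vval (v (M.next s)) x) (M.normal (M.next s) 2) := by
    intro s
    rw [(sharedEdge_next s).edgeInt_eq, (sharedEdge_next s).normal_eq, PolygonMesh.edgeInt,
      PolygonMesh.edgeInt, PolygonMesh.edgeInt, ← segInt_add (.of_continuous (hcont _ _ _))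
      (.of_continuous (hcont _ _ _))]
    refine segInt_congr fun x hx => ?_
    rw [inner_neg_right, ← sub_eq_zero.1 (hv.2 s x hx)]
    ring
  -- After integration by parts on each triangle, continuity of `v·n` makes the boundary terms on
  -- `F_p` cancel the jump terms of `b_h`; only the polygon sides survive.
  rw [bh, Finset.sum_congr rfl fun s _ => integral_inner_vval_pgrad s (v s) (q s),
    Finset.sum_sub_distrib, sum_edges, Finset.sum_congr rfl fun s _ => hnext s]
  ring

/-- The two forms are adjoint to each other. -/
lemma bh_eq_bhStar {k : ℕ} {v : M.PVector} {q : M.PScalar} (hv : v ∈ M.Vh k) (hq : q ∈ M.Sh k) :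
    bh v q = bhStar q v := by
  rw [bh_eq hv, bhStar_eq hq]

/-! ### Differences in the discrete spaces and forms -/

lemma Vh.sub_mem {k : ℕ} {v w : M.PVector} (hv : v ∈ M.Vh k) (hw : w ∈ M.Vh k) :
    v - w ∈ M.Vh k := by
  refine ⟨fun s i => (totalDegree_sub _ _).trans (max_le (hv.1 s i) (hw.1 s i)), fun s x hx => ?_⟩
  have h1 := hv.2 s x hx
  have h2 := hw.2 s x hx
  simp only [Pi.sub_apply, vval_sub, inner_sub_left]
  linarith

lemma Sh.sub_mem {k : ℕ} {p q : M.PScalar} (hp : p ∈ M.Sh k) (hq : q ∈ M.Sh k) :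
    p - q ∈ M.Sh k := by
  refine ⟨fun s => (totalDegree_sub _ _).trans (max_le (hp.1 s) (hq.1 s)), fun e x hx => ?_,
    fun b x hx => ?_⟩
  · have h1 := hp.2.1 e x hx
    have h2 := hq.2.1 e x hx
    simp only [Pi.sub_apply, pval_sub]
    linarith
  · have h1 := hp.2.2 b x hx
    have h2 := hq.2.2 b x hx
    simp only [Pi.sub_apply, pval_sub]
    linarith

lemma bh_sub_left (v w : M.PVector) (q : M.PScalar) : bh (v - w) q = bh v q - bh w q := by
  have h1 : ∀ s, (M.edgeInt s 1 fun x => inner ℝ (vval ((v - w) s) x) (M.normal s 1) *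
      (pval (q s) x - pval (q (M.next s)) x)) =
      (M.edgeInt s 1 fun x => inner ℝ (vval (v s) x) (M.normal s 1) *
        (pval (q s) x - pval (q (M.next s)) x)) -
      M.edgeInt s 1 fun x => inner ℝ (vval (w s) x) (M.normal s 1) *
        (pval (q s) x - pval (q (M.next s)) x) := by
    intro s
    have hc : ∀ v : Fin 2 → Poly2, Continuous fun x => inner ℝ (vval v x) (M.normal s 1) *
        (pval (q s) x - pval (q (M.next s)) x) := fun v =>
      ((continuous_vval v).inner continuous_const).mul
        ((continuous_pval _).sub (continuous_pval _))
    rw [PolygonMesh.edgeInt, PolygonMesh.edgeInt, PolygonMesh.edgeInt,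
      ← segInt_sub (.of_continuous (hc _)) (.of_continuous (hc _))]
    refine segInt_congr fun x _ => ?_
    simp only [Pi.sub_apply, vval_sub, inner_sub_left]
    ring
  have h2 : ∀ s : M.Tri, (∫ x in M.tri s, inner ℝ (vval ((v - w) s) x) (pgrad (q s) x)) =
      (∫ x in M.tri s, inner ℝ (vval (v s) x) (pgrad (q s) x)) -
      ∫ x in M.tri s, inner ℝ (vval (w s) x) (pgrad (q s) x) := by
    intro s
    rw [← integral_sub (integrable_inner_of_memLp (memLp_vval _ s) (memLp_pgrad _ s))
      (integrable_inner_of_memLp (memLp_vval _ s) (memLp_pgrad _ s))]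
    simp only [Pi.sub_apply, vval_sub, inner_sub_left]
  simp only [bh, h1, h2, Finset.sum_sub_distrib]
  ring

lemma bh_sub_right (v : M.PVector) (p q : M.PScalar) : bh v (p - q) = bh v p - bh v q := by
  have h1 : ∀ s, (M.edgeInt s 1 fun x => inner ℝ (vval (v s) x) (M.normal s 1) *
      (pval ((p - q) s) x - pval ((p - q) (M.next s)) x)) =
      (M.edgeInt s 1 fun x => inner ℝ (vval (v s) x) (M.normal s 1) *
        (pval (p s) x - pval (p (M.next s)) x)) -
      M.edgeInt s 1 fun x => inner ℝ (vval (v s) x) (M.normal s 1) *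
        (pval (q s) x - pval (q (M.next s)) x) := by
    intro s
    have hc : ∀ q : M.PScalar, Continuous fun x => inner ℝ (vval (v s) x) (M.normal s 1) *
        (pval (q s) x - pval (q (M.next s)) x) := fun q =>
      ((continuous_vval _).inner continuous_const).mul
        ((continuous_pval _).sub (continuous_pval _))
    rw [PolygonMesh.edgeInt, PolygonMesh.edgeInt, PolygonMesh.edgeInt,
      ← segInt_sub (.of_continuous (hc _)) (.of_continuous (hc _))]
    refine segInt_congr fun x _ => ?_
    simp only [Pi.sub_apply, pval_sub]
    ring
  have h2 : ∀ s : M.Tri, (∫ x in M.tri s, inner ℝ (vval (v s) x) (pgrad ((p - q) s) x)) =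
      (∫ x in M.tri s, inner ℝ (vval (v s) x) (pgrad (p s) x)) -
      ∫ x in M.tri s, inner ℝ (vval (v s) x) (pgrad (q s) x) := by
    intro s
    rw [← integral_sub (integrable_inner_of_memLp (memLp_vval _ s) (memLp_pgrad _ s))
      (integrable_inner_of_memLp (memLp_vval _ s) (memLp_pgrad _ s))]
    simp only [Pi.sub_apply, pgrad_sub, inner_sub_right]
  simp only [bh, h1, h2, Finset.sum_sub_distrib]
  ring

end FracturedMesh

/-! # The weighted inner product -/

lemma mulVecP_apply (A : Matrix (Fin 2) (Fin 2) ℝ) (v : Plane) (i : Fin 2) :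
    mulVecP A v i = A i 0 * v 0 + A i 1 * v 1 :=
  Fin.sum_univ_two fun j => A i j * v j

lemma mulVecP_add (A : Matrix (Fin 2) (Fin 2) ℝ) (v w : Plane) :
    mulVecP A (v + w) = mulVecP A v + mulVecP A w := by
  ext i; simp only [mulVecP_apply, PiLp.add_apply]; ring

lemma mulVecP_smul (A : Matrix (Fin 2) (Fin 2) ℝ) (c : ℝ) (v : Plane) :
    mulVecP A (c • v) = c • mulVecP A v := by
  ext i; simp only [mulVecP_apply, PiLp.smul_apply, smul_eq_mul]; ring

lemma mulVecP_sub (A : Matrix (Fin 2) (Fin 2) ℝ) (v w : Plane) :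
    mulVecP A (v - w) = mulVecP A v - mulVecP A w := by
  ext i; simp only [mulVecP_apply, PiLp.sub_apply]; ring

lemma mulVecP_neg (A : Matrix (Fin 2) (Fin 2) ℝ) (v : Plane) :
    mulVecP A (-v) = -mulVecP A v := by
  ext i; simp only [mulVecP_apply, PiLp.neg_apply]; ring

lemma mulVecP_mulVecP (A B : Matrix (Fin 2) (Fin 2) ℝ) (v : Plane) :
    mulVecP A (mulVecP B v) = mulVecP (A * B) v := by
  ext i; simp only [mulVecP_apply, Matrix.mul_apply, Fin.sum_univ_two]; ring

lemma mulVecP_one (v : Plane) : mulVecP 1 v = v := by simp [mulVecP]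

section Coercive

variable {A : Matrix (Fin 2) (Fin 2) ℝ} {c : ℝ}

lemma mul_norm_sq_le_of_coercive (h : ∀ z : Plane, ‖z‖ = 1 → c ≤ inner ℝ (mulVecP A z) z)
    (z : Plane) : c * ‖z‖ ^ 2 ≤ inner ℝ (mulVecP A z) z := by
  rcases eq_or_ne z 0 with rfl | hz
  · simp
  have hz' := norm_ne_zero_iff.2 hz
  have h1 := h (‖z‖⁻¹ • z) (by rw [norm_smul, norm_inv, norm_norm, inv_mul_cancel₀ hz'])
  rw [mulVecP_smul, inner_smul_left, inner_smul_right] at h1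
  have h2 := mul_le_mul_of_nonneg_right h1 (sq_nonneg ‖z‖)
  refine h2.trans_eq ?_
  simp only [conj_trivial]
  field_simp

lemma isUnit_det_of_coercive (hc : 0 < c) (h : ∀ z : Plane, ‖z‖ = 1 → c ≤ inner ℝ (mulVecP A z) z) :
    IsUnit A.det := by
  rw [isUnit_iff_ne_zero]
  intro h0
  obtain ⟨v, hv, hv0⟩ := Matrix.exists_mulVec_eq_zero_iff.2 h0
  have h1 := mul_norm_sq_le_of_coercive h (WithLp.toLp 2 v)
  have h2 : mulVecP A (WithLp.toLp 2 v) = 0 := by rw [mulVecP, hv0]; rfl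
  rw [h2, inner_zero_left] at h1
  have h3 : 0 < ‖(WithLp.toLp 2 v : Plane)‖ := norm_pos_iff.2 fun h => hv (by
    ext i; exact congrFun (congrArg WithLp.ofLp h) i)
  have : 0 < c * ‖(WithLp.toLp 2 v : Plane)‖ ^ 2 := by positivity
  linarith

lemma mulVecP_mulVecP_inv (hA : IsUnit A.det) (v : Plane) : mulVecP A (mulVecP A⁻¹ v) = v := by
  rw [mulVecP_mulVecP, Matrix.mul_nonsing_inv _ hA, mulVecP_one]

lemma mulVecP_inv_mulVecP (hA : IsUnit A.det) (v : Plane) : mulVecP A⁻¹ (mulVecP A v) = v := by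
  rw [mulVecP_mulVecP, Matrix.nonsing_inv_mul _ hA, mulVecP_one]

/-- With `z = A⁻¹ w` the expression is the inner product of `A z` and `z`, up to order. -/
lemma inner_mulVecP_inv_self_nonneg (hc : 0 < c)
    (h : ∀ z : Plane, ‖z‖ = 1 → c ≤ inner ℝ (mulVecP A z) z) (w : Plane) :
    0 ≤ inner ℝ (mulVecP A⁻¹ w) w := by
  have h1 := mul_norm_sq_le_of_coercive h (mulVecP A⁻¹ w)
  rw [mulVecP_mulVecP_inv (isUnit_det_of_coercive hc h), real_inner_comm] at h1
  exact le_trans (by positivity) h1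

/-- With `z = A⁻¹ w`, coercivity and Cauchy–Schwarz give `c ‖z‖² ≤ ⟨w, z⟩ ≤ ‖w‖ ‖z‖`; the case `z =
0` is separate because one factor `‖z‖` is cancelled. -/
lemma norm_mulVecP_inv_le (hc : 0 < c)
    (h : ∀ z : Plane, ‖z‖ = 1 → c ≤ inner ℝ (mulVecP A z) z) (w : Plane) :
    ‖mulVecP A⁻¹ w‖ ≤ c⁻¹ * ‖w‖ := by
  have h1 := mul_norm_sq_le_of_coercive h (mulVecP A⁻¹ w)
  rw [mulVecP_mulVecP_inv (isUnit_det_of_coercive hc h)] at h1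
  have h2 := h1.trans (real_inner_le_norm _ _)
  rcases (norm_nonneg (mulVecP A⁻¹ w)).eq_or_lt with h0 | h0
  · rw [← h0]; positivity
  · rw [inv_mul_eq_div, le_div_iff₀ hc]
    refine le_of_mul_le_mul_right ?_ h0
    nlinarith

lemma inner_mulVecP_inv_comm (hA : A.IsSymm) (v w : Plane) :
    inner ℝ (mulVecP A⁻¹ v) w = inner ℝ (mulVecP A⁻¹ w) v := by
  have h : A⁻¹ 1 0 = A⁻¹ 0 1 := hA.inv.apply 0 1
  simp only [inner_plane, mulVecP_apply, h]
  ring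

end Coercive

namespace FracturedMesh

variable {M : FracturedMesh}

namespace Data

variable (D : M.Data)

/-- The adjugate formula expresses the entries through those of `K`. Since inversion of reals is
total, it holds at every `x`, also where the determinant is zero. -/
lemma measurable_inv_apply (i j : Fin 2) : Measurable fun x => (D.K x)⁻¹ i j := by
  have h : ∀ x, (D.K x)⁻¹ i j = (D.K x 0 0 * D.K x 1 1 - D.K x 0 1 * D.K x 1 0)⁻¹ *
      (!![D.K x 1 1, -D.K x 0 1; -D.K x 1 0, D.K x 0 0] : Matrix (Fin 2) (Fin 2) ℝ) i j := by
    intro x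
    rw [Matrix.inv_def, Matrix.adjugate_fin_two, Matrix.det_fin_two, Ring.inverse_eq_inv']
    rfl
  simp only [h]
  have h1 := D.K_meas
  have hdet : Measurable fun x => (D.K x 0 0 * D.K x 1 1 - D.K x 0 1 * D.K x 1 0)⁻¹ :=
    (((h1 0 0).mul (h1 1 1)).sub ((h1 0 1).mul (h1 1 0))).inv
  refine hdet.mul ?_
  fin_cases i <;> fin_cases j
  · exact h1 1 1
  · exact (h1 0 1).neg
  · exact (h1 1 0).neg
  · exact h1 0 0

lemma ae_coercive (s : M.Tri) : ∀ᵐ x ∂(volume.restrict (M.tri s)), ∀ z : Plane, ‖z‖ = 1 →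
    D.K₁ ≤ inner ℝ (mulVecP (D.K x) z) z :=
  (M.ae_tri D.K_ell s).mono fun _ h z hz => (h z hz).1

/-- The lower ellipticity bound controls `K⁻¹` by the constant `K₁⁻¹` almost everywhere. -/
lemma memLp_Kinv {s : M.Tri} {w : Plane → Plane} (hw : MemLp w 2 (volume.restrict (M.tri s))) :
    MemLp (fun x => mulVecP (D.K x)⁻¹ (w x)) 2 (volume.restrict (M.tri s)) := by
  refine hw.of_le_mul (c := D.K₁⁻¹) ?_ ((D.ae_coercive s).mono fun x hx =>
    norm_mulVecP_inv_le D.K₁_pos hx _)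
  have h : AEStronglyMeasurable (fun x i => mulVecP (D.K x)⁻¹ (w x) i)
      (volume.restrict (M.tri s)) := by
    refine (aemeasurable_pi_lambda _ fun i => ?_).aestronglyMeasurable
    simp only [mulVecP_apply]
    exact ((D.measurable_inv_apply i 0).aemeasurable.mul
      (hw.eval_piLp 0).aestronglyMeasurable.aemeasurable).add
      ((D.measurable_inv_apply i 1).aemeasurable.mul
      (hw.eval_piLp 1).aestronglyMeasurable.aemeasurable)
  exact (PiLp.continuous_toLp 2 fun _ : Fin 2 => ℝ).comp_aestronglyMeasurable h

lemma integrable_Kinv {s : M.Tri} {v w : Plane → Plane}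
    (hv : MemLp v 2 (volume.restrict (M.tri s))) (hw : MemLp w 2 (volume.restrict (M.tri s))) :
    Integrable (fun x => inner ℝ (mulVecP (D.K x)⁻¹ (v x)) (w x)) (volume.restrict (M.tri s)) :=
  integrable_inner_of_memLp (D.memLp_Kinv hv) hw

lemma integral_Kinv_self_nonneg (s : M.Tri) (w : Plane → Plane) :
    0 ≤ ∫ x in M.tri s, inner ℝ (mulVecP (D.K x)⁻¹ (w x)) (w x) :=
  integral_nonneg_of_ae ((D.ae_coercive s).mono fun _ hx =>
    inner_mulVecP_inv_self_nonneg D.K₁_pos hx _)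

lemma KinvNormSq_nonneg (w : M.Tri → Plane → Plane) : 0 ≤ D.KinvNormSq w :=
  Finset.sum_nonneg fun s _ => D.integral_Kinv_self_nonneg s (w s)

/-- Young's inequality for the weighted inner product. -/
lemma neg_two_mul_integral_Kinv_le {s : M.Tri} {v w : Plane → Plane}
    (hv : MemLp v 2 (volume.restrict (M.tri s))) (hw : MemLp w 2 (volume.restrict (M.tri s))) :
    -(2 * ∫ x in M.tri s, inner ℝ (mulVecP (D.K x)⁻¹ (v x)) (w x)) ≤
      (∫ x in M.tri s, inner ℝ (mulVecP (D.K x)⁻¹ (v x)) (v x)) +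
        ∫ x in M.tri s, inner ℝ (mulVecP (D.K x)⁻¹ (w x)) (w x) := by
  -- Young's inequality is nonnegativity of the energy of `v + w`; symmetry of `K` merges the two
  -- mixed terms.
  have h0 := D.integral_Kinv_self_nonneg s fun x => v x + w x
  have h1 : (∫ x in M.tri s, inner ℝ (mulVecP (D.K x)⁻¹ (v x + w x)) (v x + w x)) =
      ∫ x in M.tri s, ((inner ℝ (mulVecP (D.K x)⁻¹ (v x)) (v x) +
        inner ℝ (mulVecP (D.K x)⁻¹ (w x)) (w x)) +
        2 * inner ℝ (mulVecP (D.K x)⁻¹ (v x)) (w x)) := by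
    refine integral_congr_ae ((M.ae_tri D.K_symm s).mono fun x hx => ?_)
    simp only [mulVecP_add, inner_add_left, inner_add_right]
    rw [inner_mulVecP_inv_comm hx (w x) (v x)]
    ring
  have hi : Integrable (fun x => inner ℝ (mulVecP (D.K x)⁻¹ (v x)) (v x) +
      inner ℝ (mulVecP (D.K x)⁻¹ (w x)) (w x)) (volume.restrict (M.tri s)) :=
    (D.integrable_Kinv hv hv).add (D.integrable_Kinv hw hw)
  rw [h1, integral_add hi ((D.integrable_Kinv hv hw).const_mul 2), integral_add (D.integrable_Kinv hv hv)
    (D.integrable_Kinv hw hw), integral_const_mul] at h0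
  linarith

lemma α_pos (i : Fin M.nF) : 0 < D.α i := by
  have h := D.ξ_gt
  exact mul_pos (div_pos (D.ℓ_pos i) (D.κn_pos i)) (by linarith)

lemma η_pos (i : Fin M.nF) : 0 < D.η i := div_pos (D.ℓ_pos i) (D.κn_pos i)

lemma KΓ_pos (i : Fin M.nF) : 0 < D.KΓ i := mul_pos (D.κt_pos i) (D.ℓ_pos i)

end Data

/-! # Functions on the fracture -/

/-- Along each edge the function is a primitive of an integrable function, hence continuous. -/
lemma H10.segL2_val (q : M.H10) (i : Fin M.nF) :
    SegL2 (M.γ i.castSucc) (M.γ i.succ) q.val := by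
  refine .of_continuousOn ?_
  have hint : IntegrableOn (fun r => q.der (segPt (M.γ i.castSucc) (M.γ i.succ) r))
      (Set.Icc 0 1) := (q.der_L2 i).integrable one_le_two
  have h := intervalIntegral.continuousOn_primitive_interval
    (by rwa [Set.uIcc_of_le zero_le_one] : IntegrableOn _ (Set.uIcc (0 : ℝ) 1) volume)
  rw [Set.uIcc_of_le zero_le_one] at h
  exact ((continuousOn_const.add (continuousOn_const.mul h))).congr fun t ht => q.ac i t ht

/-- The difference of two functions in `H¹₀(Γ)`. -/
def H10.diff (p q : M.H10) : M.H10 where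
  val x := p.val x - q.val x
  der x := p.der x - q.der x
  der_L2 i := (p.der_L2 i).sub (q.der_L2 i)
  ac i t ht := by
    have hint : ∀ q : M.H10, IntervalIntegrable
        (fun r => q.der (segPt (M.γ i.castSucc) (M.γ i.succ) r)) volume 0 t := fun q => by
      rw [intervalIntegrable_iff_integrableOn_Icc_of_le ht.1]
      exact IntegrableOn.mono_set (t := Set.Icc 0 1) ((q.der_L2 i).integrable one_le_two)
        (Set.Icc_subset_Icc_right ht.2)
    rw [p.ac i t ht, q.ac i t ht, intervalIntegral.integral_sub (hint p) (hint q)]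
    ring
  val_first := by rw [p.val_first, q.val_first, sub_zero]
  val_last := by rw [p.val_last, q.val_last, sub_zero]

lemma H10.diff_mem_Wh {k : ℕ} {p q : M.H10} (hp : p ∈ M.Wh k) (hq : q ∈ M.Wh k) :
    p.diff q ∈ M.Wh k := by
  intro i
  obtain ⟨P, hP, hP'⟩ := hp i
  obtain ⟨Q, hQ, hQ'⟩ := hq i
  refine ⟨P - Q, (MvPolynomial.totalDegree_sub _ _).trans (max_le hP hQ), fun x hx => ?_⟩
  rw [pval_sub, ← hP' x hx, ← hQ' x hx, H10.diff]

lemma segL2_fracSide {t : M.Tri → Fin 3 → Plane → ℝ}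
    (ht : ∀ s i, SegL2 (M.corner s i) (M.corner s (i + 1)) (t s i)) (i : Fin M.nF) (j : Fin 2) :
    SegL2 (M.γ i.castSucc) (M.γ i.succ) (t (M.fracSide i j) 0) := by
  fin_cases j
  · have h := ht (M.fracSide i 0) 0
    rwa [zero_add, (M.frac_match₁ i).1, (M.frac_match₁ i).2] at h
  · have h := (ht (M.fracSide i 1) 0).comm
    rwa [zero_add, (M.frac_match₂ i).1, (M.frac_match₂ i).2] at h

lemma segL2_avg (q : M.PScalar) (i : Fin M.nF) (a b : Plane) : SegL2 a b (avg q i) :=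
  .of_continuous (((continuous_pval _).add (continuous_pval _)).div_const _)

lemma segL2_jump (q : M.PScalar) (i : Fin M.nF) (a b : Plane) : SegL2 a b (jump q i) :=
  .of_continuous ((continuous_pval _).sub (continuous_pval _))

lemma avg_sub (p q : M.PScalar) (i : Fin M.nF) (x : Plane) :
    avg (p - q) i x = avg p i x - avg q i x := by
  simp only [avg, Pi.sub_apply, pval_sub]; ring

lemma jump_sub (p q : M.PScalar) (i : Fin M.nF) (x : Plane) :
    jump (p - q) i x = jump p i x - jump q i x := by
  simp only [jump, Pi.sub_apply, pval_sub]; ring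

end FracturedMesh

/-! # Consistency of the scheme and the error estimate -/

namespace FracturedMesh

open MvPolynomial

variable {M : FracturedMesh} {D : M.Data} {S : Solution D} {k : ℕ}

lemma IsInterpI.integral_mul_eq {w : M.PScalar} (hw : IsInterpI S k w) (s : M.Tri) {ψ : Poly2}
    (hψ : ψ = 0 ∨ ψ.totalDegree < k) :
    ∫ x in M.tri s, S.p x * pval ψ x = ∫ x in M.tri s, pval (w s) x * pval ψ x := by
  have hp := M.memLp_tri S.p_H1.1 s
  have h1 : Integrable (fun x => S.p x * pval ψ x) (volume.restrict (M.tri s)) :=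
    hp.integrable_mul (memLp_pval ψ s)
  have h2 : Integrable (fun x => pval (w s) x * pval ψ x) (volume.restrict (M.tri s)) :=
    (memLp_pval (w s) s).integrable_mul (memLp_pval ψ s)
  rcases hψ with rfl | hψ
  · simp [pval]
  · have h := hw.2.2 s ψ hψ
    simp only [sub_mul] at h
    rw [integral_sub h2 h1] at h
    linarith

lemma IsInterpI.edgeInt_mul_eq {w : M.PScalar} (hw : IsInterpI S k w) (s : M.Tri) {ψ : Poly2}
    (hψ : ψ.totalDegree ≤ k) :
    (M.edgeInt s 0 fun x => S.trp s 0 x * pval ψ x) =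
      M.edgeInt s 0 fun x => pval (w s) x * pval ψ x := by
  have h := hw.2.1 s ψ hψ
  simp only [sub_mul] at h
  rw [PolygonMesh.edgeInt, segInt_sub ((segL2_pval _ _ _).mul (segL2_pval _ _ _))
    ((S.trp_spec.1 s 0).mul (segL2_pval _ _ _))] at h
  rw [PolygonMesh.edgeInt, PolygonMesh.edgeInt]
  linarith

/-- This makes the divergence of a discrete field a legitimate test polynomial for the element
moments of `I_h`. -/
lemma totalDegree_div_lt {v : Fin 2 → Poly2} (hv : ∀ i, (v i).totalDegree ≤ k) :
    ∑ i, pderiv i (v i) = 0 ∨ (∑ i, pderiv i (v i)).totalDegree < k := by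
  rcases Nat.eq_zero_or_pos k with rfl | hk
  · left
    refine Finset.sum_eq_zero fun i _ => ?_
    exact (pderiv_eq_zero_or_totalDegree_lt (hv i) i).resolve_right (by omega)
  · right
    refine (totalDegree_finsetSum_le (d := k - 1) fun i _ => ?_).trans_lt (by omega)
    have := totalDegree_pderiv_lt (hv i) hk.ne' i
    omega

/-- Consistency of the discrete gradient. -/
lemma IsInterpI.sum_integral_inner_gradp {w : M.PScalar} (hw : IsInterpI S k w) {v : M.PVector}
    (hv : v ∈ M.Vh k) :
    ∑ s : M.Tri, ∫ x in M.tri s, inner ℝ (vval (v s) x) (S.gradp x) = bhStar w v := by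
  have hloc : ∀ s : M.Tri, (∫ x in M.tri s, inner ℝ (vval (v s) x) (S.gradp x)) =
      (∑ i, M.edgeInt s i fun x => S.trp s i x * inner ℝ (vval (v s) x) (M.normal s i)) -
        ∫ x in M.tri s, pval (w s) x * vdiv (v s) x := by
    intro s
    rw [green_vval (M.memLp_tri S.p_H1.1 s) (M.memLp_tri S.p_H1.2.1 s) (S.trp_spec.1 s)
      (S.trp_spec.2 s) (v s)]
    congr 1
    simp only [vdiv_eq_pval]
    exact hw.integral_mul_eq s (totalDegree_div_lt (hv.1 s))
  -- On `F_p` the trace of `p` is single-valued and `v·n` is continuous, so the two contributions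
  -- cancel. No moment of `I_h` on these edges is needed.
  have hnext : ∀ s, (M.edgeInt s 1 fun x => S.trp s 1 x * inner ℝ (vval (v s) x) (M.normal s 1)) +
      (M.edgeInt (M.next s) 2 fun x => S.trp (M.next s) 2 x *
        inner ℝ (vval (v (M.next s)) x) (M.normal (M.next s) 2)) = 0 := by
    intro s
    have he := sharedEdge_next s
    rw [he.edgeInt_eq, he.normal_eq, add_eq_zero_iff_eq_neg', PolygonMesh.edgeInt,
      PolygonMesh.edgeInt, ← segInt_neg]
    refine segInt_congr_ae (((S.trp_spec.segAE_eq S.p_H1 he).and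
      (.of_forall_mem (hv.2 s))).mono fun x hx => ?_)
    rw [inner_neg_right, ← sub_eq_zero.1 hx.2, hx.1]
    ring
  have hside : ∀ s, (M.edgeInt s 0 fun x => S.trp s 0 x * inner ℝ (vval (v s) x) (M.normal s 0)) =
      M.edgeInt s 0 fun x => pval (w s) x * inner ℝ (vval (v s) x) (M.normal s 0) := by
    intro s
    simp only [← pval_innerPoly]
    exact hw.edgeInt_mul_eq s (totalDegree_innerPoly_le (hv.1 s) _)
  rw [bhStar_eq hw.1, Finset.sum_congr rfl fun s _ => hloc s, Finset.sum_sub_distrib, sum_edges,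
    Finset.sum_congr rfl fun s _ => hside s, Finset.sum_eq_zero fun s _ => hnext s, add_zero]

/-- Darcy's law solved for the gradient, which turns the first equation of the scheme into a
statement about `∇p` alone. -/
lemma mulVecP_inv_u_ae (S : Solution D) (s : M.Tri) :
    ∀ᵐ x ∂(volume.restrict (M.tri s)), mulVecP (D.K x)⁻¹ (S.u x) = -S.gradp x := by
  filter_upwards [M.ae_tri S.darcy s, D.ae_coercive s] with x h1 h2
  rw [eq_neg_of_add_eq_zero_left h1, mulVecP_neg,
    mulVecP_inv_mulVecP (isUnit_det_of_coercive D.K₁_pos h2)]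

/-- The exact flux satisfies the first equation of the scheme. -/
lemma IsInterpI.flux_eq {w : M.PScalar} (hw : IsInterpI S k w) {v : M.PVector}
    (hv : v ∈ M.Vh k) :
    (∑ s : M.Tri, ∫ x in M.tri s, inner ℝ (mulVecP (D.K x)⁻¹ (S.u x)) (vval (v s) x)) +
      bhStar w v = 0 := by
  rw [← hw.sum_integral_inner_gradp hv, ← Finset.sum_add_distrib]
  refine Finset.sum_eq_zero fun s _ => ?_
  rw [add_eq_zero_iff_eq_neg, ← integral_neg]
  refine integral_congr_ae ((mulVecP_inv_u_ae S s).mono fun x hx => ?_)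
  simp only [hx, inner_neg_left]
  rw [real_inner_comm]

/-- The gradient of `q` has degree below `k` and is an admissible moment of `J_h`; for `k = 0` it
vanishes. -/
lemma IsInterpJ.integral_inner_eq {w : M.PVector} (hw : IsInterpJ S k w) (s : M.Tri)
    {q : Poly2} (hq : q.totalDegree ≤ k) :
    ∫ x in M.tri s, inner ℝ (S.u x) (pgrad q x) =
      ∫ x in M.tri s, inner ℝ (vval (w s) x) (pgrad q x) := by
  rcases Nat.eq_zero_or_pos k with rfl | hk
  · have h0 : ∀ x, pgrad q x = 0 := fun x => by
      ext i
      rw [pgrad_apply, (pderiv_eq_zero_or_totalDegree_lt hq i).resolve_right (by omega)]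
      simp [pval]
    simp only [h0, inner_zero_right]
  · have h := hw.2.2 s (fun i => pderiv i q) (totalDegree_pderiv_lt hq hk.ne')
    simp only [← pgrad_eq_vval, inner_sub_left] at h
    rw [integral_sub (integrable_inner_of_memLp (memLp_vval _ s) (memLp_pgrad q s))
      (integrable_inner_of_memLp (M.memLp_tri S.mass.1 s) (memLp_pgrad q s))] at h
    linarith

lemma IsInterpJ.edgeInt_mul_eq {w : M.PVector} (hw : IsInterpJ S k w) (s : M.Tri)
    {ψ : Poly2} (hψ : ψ.totalDegree ≤ k) :
    (M.edgeInt s 1 fun x => S.tru s 1 x * pval ψ x) =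
      M.edgeInt s 1 fun x => inner ℝ (vval (w s) x) (M.normal s 1) * pval ψ x := by
  have h := hw.2.1 s 1 (by decide) ψ hψ
  simp only [sub_mul] at h
  rw [PolygonMesh.edgeInt, segInt_sub ((segL2_inner_vval _ _ _ _).mul (segL2_pval _ _ _))
    ((S.tru_spec.1 s 1).mul (segL2_pval _ _ _))] at h
  rw [PolygonMesh.edgeInt, PolygonMesh.edgeInt]
  linarith

/-- The balance of mass of the exact solution, tested with a discrete function. -/
lemma IsInterpJ.sum_integral_f {w : M.PVector} (hw : IsInterpJ S k w) {q : M.PScalar}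
    (hq : q ∈ M.Sh k) :
    ∑ s : M.Tri, ∫ x in M.tri s, D.f x * pval (q s) x =
      -bh w q + ∑ i, ((M.fracInt i fun x => S.tru (M.fracSide i 0) 0 x *
        pval (q (M.fracSide i 0)) x) + M.fracInt i fun x => S.tru (M.fracSide i 1) 0 x *
        pval (q (M.fracSide i 1)) x) := by
  have hloc : ∀ s : M.Tri, (∫ x in M.tri s, D.f x * pval (q s) x) =
      (∑ i, M.edgeInt s i fun x => S.tru s i x * pval (q s) x) -
        ∫ x in M.tri s, inner ℝ (vval (w s) x) (pgrad (q s) x) := by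
    intro s
    have h := S.tru_spec.2 s (pval (q s)) (contDiff_pval _)
    simp only [fderiv_pval] at h
    have hf : Integrable (fun x => D.f x * pval (q s) x) (volume.restrict (M.tri s)) :=
      (M.memLp_tri D.f_L2 s).integrable_mul (memLp_pval _ s)
    rw [integral_add (integrable_inner_of_memLp (memLp_pgrad _ s) (M.memLp_tri S.mass.1 s)) hf]
      at h
    rw [← h, ← hw.integral_inner_eq s (hq.1 s)]
    simp only [real_inner_comm]
    ring
  -- Normal traces of `u` from the two sides are opposite, leaving the flux against the jump of `q`;
  -- the edge moments of `J_h` replace this flux by a discrete one.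
  have hnext : ∀ s, (M.edgeInt s 1 fun x => S.tru s 1 x * pval (q s) x) +
      (M.edgeInt (M.next s) 2 fun x => S.tru (M.next s) 2 x * pval (q (M.next s)) x) =
      M.edgeInt s 1 fun x => inner ℝ (vval (w s) x) (M.normal s 1) *
        (pval (q s) x - pval (q (M.next s)) x) := by
    intro s
    have he := sharedEdge_next s
    have h2 : (M.edgeInt s 1 fun x => S.tru (M.next s) 2 x * pval (q (M.next s)) x) =
        -M.edgeInt s 1 fun x => S.tru s 1 x * pval (q (M.next s)) x := by
      rw [PolygonMesh.edgeInt, PolygonMesh.edgeInt, ← segInt_neg]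
      refine segInt_congr_ae ((S.tru_spec.segAE_eq S.mass he).mono fun x hx => ?_)
      rw [hx, neg_mul]
    rw [he.edgeInt_eq, h2, hw.edgeInt_mul_eq s (hq.1 s), hw.edgeInt_mul_eq s (hq.1 (M.next s)),
      ← sub_eq_add_neg, PolygonMesh.edgeInt, PolygonMesh.edgeInt, PolygonMesh.edgeInt,
      ← segInt_sub ((segL2_inner_vval _ _ _ _).mul (segL2_pval _ _ _))
        ((segL2_inner_vval _ _ _ _).mul (segL2_pval _ _ _))]
    simp only [mul_sub]
  -- Interior sides drop out by continuity of `q`, and boundary sides because `q` vanishes there;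
  -- only the fluxes through the fracture remain.
  have hint : ∀ e, (M.edgeInt (M.intSide e 0) 0 fun x => S.tru (M.intSide e 0) 0 x *
      pval (q (M.intSide e 0)) x) + (M.edgeInt (M.intSide e 1) 0 fun x =>
      S.tru (M.intSide e 1) 0 x * pval (q (M.intSide e 1)) x) = 0 := by
    intro e
    have he := sharedEdge_intSide e
    rw [he.edgeInt_eq, add_eq_zero_iff_eq_neg', PolygonMesh.edgeInt,
      PolygonMesh.edgeInt, ← segInt_neg]
    refine segInt_congr_ae (((S.tru_spec.segAE_eq S.mass he).and
      (.of_forall_mem (hq.2.1 e))).mono fun x hx => ?_)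
    rw [hx.1, sub_eq_zero.1 hx.2, neg_mul]
  have hbd : ∀ b, (M.edgeInt (M.bdSide b) 0 fun x => S.tru (M.bdSide b) 0 x *
      pval (q (M.bdSide b)) x) = 0 := by
    intro b
    rw [PolygonMesh.edgeInt, segInt_congr (g := fun _ => 0)]
    · simp [segInt]
    · intro x hx
      rw [zero_add] at hx
      rw [hq.2.2 b x hx, mul_zero]
  rw [Finset.sum_congr rfl fun s _ => hloc s, Finset.sum_sub_distrib, sum_edges, sum_sides,
    Finset.sum_congr rfl fun s _ => hnext s, Finset.sum_eq_zero fun e _ => hint e,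
    Finset.sum_eq_zero fun b _ => hbd b, bh]
  simp only [edgeInt_fracSide_zero, edgeInt_fracSide_one]
  ring

lemma IsInterpI.fracInt_sub_mul {w : M.PScalar} (hw : IsInterpI S k w) (i : Fin M.nF)
    (j : Fin 2) {ψ : Poly2} (hψ : ψ.totalDegree ≤ k) :
    (M.fracInt i fun x => (pval (w (M.fracSide i j)) x - S.trp (M.fracSide i j) 0 x) * pval ψ x)
      = 0 := by
  have h := hw.2.1 (M.fracSide i j) ψ hψ
  fin_cases j
  · rwa [Fin.zero_eta, edgeInt_fracSide_zero] at h
  · rwa [Fin.mk_one, edgeInt_fracSide_one] at h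

/-- The interface conditions, solved for the normal traces. -/
lemma Solution.segAE_interface (S : Solution D) (i : Fin M.nF) :
    SegAE (M.γ i.castSucc) (M.γ i.succ) fun x =>
      (S.tru (M.fracSide i 0) 0 x - S.tru (M.fracSide i 1) 0 x) / 2 =
        (D.η i)⁻¹ * (S.trp (M.fracSide i 0) 0 x - S.trp (M.fracSide i 1) 0 x) ∧
      S.tru (M.fracSide i 0) 0 x + S.tru (M.fracSide i 1) 0 x =
        (D.α i)⁻¹ * ((S.trp (M.fracSide i 0) 0 x + S.trp (M.fracSide i 1) 0 x) / 2 -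
          S.pΓ.val x) := by
  refine ((S.interface₁ i).and (S.interface₂ i)).mono fun x hx => ?_
  have h1 := (D.η_pos i).ne'
  have h2 := (D.α_pos i).ne'
  rw [← hx.1, ← hx.2, inv_mul_cancel_left₀ h1, inv_mul_cancel_left₀ h2]
  constructor <;> ring

lemma totalDegree_C_mul_le {q : Poly2} (hq : q.totalDegree ≤ k) (c : ℝ) :
    (C c * q).totalDegree ≤ k :=
  (totalDegree_mul _ _).trans (by simpa using hq)

/-- The normal fluxes through the fracture, tested with a discrete function. -/
lemma IsInterpI.fracInt_tru_mul {w : M.PScalar} (hw : IsInterpI S k w) {q : M.PScalar}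
    (hq : q ∈ M.Sh k) (i : Fin M.nF) :
    (M.fracInt i fun x => S.tru (M.fracSide i 0) 0 x * pval (q (M.fracSide i 0)) x) +
      (M.fracInt i fun x => S.tru (M.fracSide i 1) 0 x * pval (q (M.fracSide i 1)) x) =
    (M.fracInt i fun x => (D.α i)⁻¹ * (avg w i x - S.pΓ.val x) * avg q i x) +
      M.fracInt i fun x => (D.η i)⁻¹ * jump w i x * jump q i x := by
  set q₀ := q (M.fracSide i 0) with hq₀
  set q₁ := q (M.fracSide i 1) with hq₁
  have hd₀ : q₀.totalDegree ≤ k := hq.1 _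
  have hd₁ : q₁.totalDegree ≤ k := hq.1 _
  -- These polynomials collect everything that multiplies the trace error of `I_h p` on each side.
  -- The `1/4` comes from the two averages in the `α` term; the jumps in the `η` term give opposite
  -- signs on the two sides.
  set ψ₀ : Poly2 := C ((D.α i)⁻¹ / 4) * (q₀ + q₁) + C (D.η i)⁻¹ * (q₀ - q₁) with hψ₀
  set ψ₁ : Poly2 := C ((D.α i)⁻¹ / 4) * (q₀ + q₁) - C (D.η i)⁻¹ * (q₀ - q₁) with hψ₁
  have hadd : (q₀ + q₁).totalDegree ≤ k := (totalDegree_add _ _).trans (max_le hd₀ hd₁)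
  have hsub : (q₀ - q₁).totalDegree ≤ k := (totalDegree_sub _ _).trans (max_le hd₀ hd₁)
  have h₀ := hw.fracInt_sub_mul i 0 (ψ := ψ₀) ((totalDegree_add _ _).trans
    (max_le (totalDegree_C_mul_le hadd _) (totalDegree_C_mul_le hsub _)))
  have h₁ := hw.fracInt_sub_mul i 1 (ψ := ψ₁) ((totalDegree_sub _ _).trans
    (max_le (totalDegree_C_mul_le hadd _) (totalDegree_C_mul_le hsub _)))
  have htu := segL2_fracSide S.tru_spec.1 i
  have htp := segL2_fracSide S.trp_spec.1 i
  have hP := fun q => segL2_pval q (M.γ i.castSucc) (M.γ i.succ)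
  have i1 := (htu 0).mul (hP q₀)
  have i2 := (htu 1).mul (hP q₁)
  have i3 := ((hP (w (M.fracSide i 0))).sub (htp 0)).mul (hP ψ₀)
  have i4 := ((hP (w (M.fracSide i 1))).sub (htp 1)).mul (hP ψ₁)
  have i5 := (((segL2_avg w i _ _).sub (S.pΓ.segL2_val i)).const_mul (D.α i)⁻¹).mul
    (segL2_avg q i _ _)
  have i6 := ((segL2_jump w i (M.γ i.castSucc) (M.γ i.succ)).const_mul (D.η i)⁻¹).mul
    (segL2_jump q i _ _)
  -- The vanishing moments are added to the left-hand side, so that the claim reduces to a pointwise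
  -- identity.
  rw [← add_zero (_ + _), ← h₀, ← add_zero (_ + M.fracInt i _), ← h₁, fracInt, fracInt, fracInt,
    fracInt, fracInt, fracInt, ← segInt_add i1 i2, ← segInt_add (i1.add i2) i3,
    ← segInt_add ((i1.add i2).add i3) i4, ← segInt_add i5 i6]
  refine segInt_congr_ae ((S.segAE_interface i).mono fun x hx => ?_)
  -- This is `{u·n}[q] + [u·n]{q}`; the second normal trace is outward for `Ω₂` and enters with the
  -- opposite sign.
  have e1 : S.tru (M.fracSide i 0) 0 x * pval q₀ x + S.tru (M.fracSide i 1) 0 x * pval q₁ x =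
      (S.tru (M.fracSide i 0) 0 x - S.tru (M.fracSide i 1) 0 x) / 2 * (pval q₀ x - pval q₁ x) +
      (S.tru (M.fracSide i 0) 0 x + S.tru (M.fracSide i 1) 0 x) *
        ((pval q₀ x + pval q₁ x) / 2) := by ring
  have e2 : pval ψ₀ x = (D.α i)⁻¹ / 4 * (pval q₀ x + pval q₁ x) +
      (D.η i)⁻¹ * (pval q₀ x - pval q₁ x) := by simp [pval, hψ₀]
  have e3 : pval ψ₁ x = (D.α i)⁻¹ / 4 * (pval q₀ x + pval q₁ x) -
      (D.η i)⁻¹ * (pval q₀ x - pval q₁ x) := by simp [pval, hψ₁]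
  rw [e1, hx.1, hx.2, e2, e3]
  simp only [avg, jump, ← hq₀, ← hq₁]
  ring

/-- The exact solution satisfies the second equation of the scheme, up to the trace of `p_Γ`. -/
lemma pressure_eq {w : M.PVector} {r : M.PScalar} (hw : IsInterpJ S k w) (hr : IsInterpI S k r)
    {q : M.PScalar} (hq : q ∈ M.Sh k) :
    -bh w q + (∑ i, M.fracInt i fun x => (D.α i)⁻¹ * (avg r i x - S.pΓ.val x) * avg q i x)
      + (∑ i, M.fracInt i fun x => (D.η i)⁻¹ * jump r i x * jump q i x) =
      ∑ s : M.Tri, ∫ x in M.tri s, D.f x * pval (q s) x := by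
  rw [hw.sum_integral_f hq, Finset.sum_congr rfl fun i _ => hr.fracInt_tru_mul hq i,
    Finset.sum_add_distrib]
  ring

/-- The exact solution satisfies the third equation of the scheme. -/
lemma IsInterpI.fracture_eq {w : M.PScalar} (hw : IsInterpI S k w) {q : M.H10}
    (hq : q ∈ M.Wh k) :
    (∑ i, M.fracInt i fun x => D.KΓ i * S.pΓ.der x * q.der x)
      - (∑ i, M.fracInt i fun x => (D.α i)⁻¹ * (avg w i x - S.pΓ.val x) * q.val x)
      = ∑ i, M.fracInt i fun x => D.ℓ i * D.fΓ x * q.val x := by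
  rw [S.fracture q, ← Finset.sum_sub_distrib]
  refine Finset.sum_congr rfl fun i _ => ?_
  obtain ⟨P, hP, hPq⟩ := hq i
  -- Constancy of `α` on the edge keeps the weight polynomial; the factor `1/2` comes from the
  -- average of `p`.
  set ψ : Poly2 := C ((D.α i)⁻¹ / 2) * P with hψ
  have hψd : ψ.totalDegree ≤ k := totalDegree_C_mul_le hP _
  have h₀ := hw.fracInt_sub_mul i 0 hψd
  have h₁ := hw.fracInt_sub_mul i 1 hψd
  have htu := segL2_fracSide S.tru_spec.1 i
  have htp := segL2_fracSide S.trp_spec.1 i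
  have hL := fun q => segL2_pval q (M.γ i.castSucc) (M.γ i.succ)
  have hqv := q.segL2_val i
  have i1 := (((D.fΓ_L2 i).const_mul (D.ℓ i)).add ((htu 0).add (htu 1))).mul hqv
  have i2 := (((segL2_avg w i _ _).sub (S.pΓ.segL2_val i)).const_mul (D.α i)⁻¹).mul hqv
  have i3 := ((hL (w (M.fracSide i 0))).sub (htp 0)).mul (hL ψ)
  have i4 := ((hL (w (M.fracSide i 1))).sub (htp 1)).mul (hL ψ)
  simp only [sub_neg_eq_add]
  rw [← add_zero (_ - _), ← h₀, ← add_zero (_ + M.fracInt i _), ← h₁, fracInt, fracInt, fracInt,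
    fracInt, fracInt, ← segInt_sub i1 i2, ← segInt_add (i1.sub i2) i3,
    ← segInt_add ((i1.sub i2).add i3) i4]
  refine segInt_congr_ae (((S.segAE_interface i).and (.of_forall_mem hPq)).mono fun x hx => ?_)
  have e : pval ψ x = (D.α i)⁻¹ / 2 * q.val x := by rw [hx.2]; simp [pval, hψ]
  rw [hx.1.2, e]
  simp only [avg]
  ring

/-! ### Error equations and the energy estimate -/

section Energy

variable {uh : M.PVector} {ph : M.PScalar} {pΓh : M.H10} {Jhu : M.PVector} {Ihp : M.PScalar}
  {Rp : M.H10}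

/-- The error equation for the flux, tested with the error of the flux. -/
lemma flux_error_eq (hD : IsDiscreteSolution D k uh ph pΓh) (hJ : IsInterpJ S k Jhu)
    (hI : IsInterpI S k Ihp) :
    D.KinvNormSq (fun s x => vval (Jhu s) x - vval (uh s) x) +
      (∑ s : M.Tri, ∫ x in M.tri s, inner ℝ (mulVecP (D.K x)⁻¹ (S.u x - vval (Jhu s) x))
        (vval (Jhu s) x - vval (uh s) x)) +
      (bhStar Ihp (Jhu - uh) - bhStar ph (Jhu - uh)) = 0 := by
  have hv := Vh.sub_mem hJ.1 hD.uh_mem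
  have h1 := hI.flux_eq hv
  have h2 := hD.flux _ hv
  -- The flux error is split as `u - u_h = (u - J_h u) + (J_h u - u_h)`.
  have h3 : ∀ s : M.Tri, (∫ x in M.tri s, inner ℝ (mulVecP (D.K x)⁻¹ (S.u x))
      (vval ((Jhu - uh) s) x)) - (∫ x in M.tri s, inner ℝ (mulVecP (D.K x)⁻¹ (vval (uh s) x))
      (vval ((Jhu - uh) s) x)) = (∫ x in M.tri s, inner ℝ (mulVecP (D.K x)⁻¹
      (vval (Jhu s) x - vval (uh s) x)) (vval (Jhu s) x - vval (uh s) x)) +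
      ∫ x in M.tri s, inner ℝ (mulVecP (D.K x)⁻¹ (S.u x - vval (Jhu s) x))
        (vval (Jhu s) x - vval (uh s) x) := by
    intro s
    have hu := M.memLp_tri S.mass.1 s
    have hl := fun v => memLp_vval v s
    have he : MemLp (fun x => vval (Jhu s) x - vval (uh s) x) 2 (volume.restrict (M.tri s)) :=
      (hl _).sub (hl _)
    have hr : MemLp (fun x => S.u x - vval (Jhu s) x) 2 (volume.restrict (M.tri s)) :=
      hu.sub (hl _)
    rw [← integral_sub (D.integrable_Kinv hu (hl _)) (D.integrable_Kinv (hl _) (hl _)),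
      ← integral_add (D.integrable_Kinv he he) (D.integrable_Kinv hr he)]
    refine integral_congr_ae (.of_forall fun x => ?_)
    simp only [Pi.sub_apply, vval_sub, mulVecP_sub, inner_sub_left]
    ring
  have h4 := Finset.sum_congr rfl fun s (_ : s ∈ (Finset.univ : Finset M.Tri)) => h3 s
  rw [Finset.sum_sub_distrib, Finset.sum_add_distrib] at h4
  rw [Data.KinvNormSq]
  linarith

/-- The error equation for the pressure in the fracture, tested with the error of that pressure. -/
lemma fracture_error_eq (hD : IsDiscreteSolution D k uh ph pΓh) (hI : IsInterpI S k Ihp)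
    (hR : IsRitz D k S.pΓ Rp) :
    (∑ i, M.fracInt i fun x => D.KΓ i * (Rp.der x - pΓh.der x) ^ 2) =
      (∑ i, M.fracInt i fun x => (D.α i)⁻¹ * (avg Ihp i x - S.pΓ.val x) *
        (Rp.val x - pΓh.val x)) -
      ∑ i, M.fracInt i fun x => (D.α i)⁻¹ * (avg ph i x - pΓh.val x) *
        (Rp.val x - pΓh.val x) := by
  have hq := H10.diff_mem_Wh hR.1 hD.pΓh_mem
  have h1 := hI.fracture_eq hq
  have h2 := hD.fracture _ hq
  -- The Ritz projection replaces `p_Γ` in the stiffness term without any remainder.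
  have h3 := hR.2 _ hq
  have h4 : ∀ i, (M.fracInt i fun x => D.KΓ i * (Rp.der x - pΓh.der x) ^ 2) =
      (M.fracInt i fun x => D.KΓ i * Rp.der x * (Rp.diff pΓh).der x) -
        M.fracInt i fun x => D.KΓ i * pΓh.der x * (Rp.diff pΓh).der x := by
    intro i
    have hd := (Rp.diff pΓh).der_L2 i
    rw [fracInt, fracInt, fracInt, ← segInt_sub (((Rp.der_L2 i).const_mul _).mul hd)
      (((pΓh.der_L2 i).const_mul _).mul hd)]
    refine segInt_congr fun x _ => ?_
    simp only [H10.diff]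
    ring
  rw [Finset.sum_congr rfl fun i _ => h4 i, Finset.sum_sub_distrib]
  simp only [H10.diff] at h1 h2 h3 ⊢
  linarith

/-- The error equation for the pressure in the bulk region, tested with the error of that
pressure. -/
lemma pressure_error_eq (hD : IsDiscreteSolution D k uh ph pΓh) (hJ : IsInterpJ S k Jhu)
    (hI : IsInterpI S k Ihp) :
    (∑ i, M.fracInt i fun x => (D.η i)⁻¹ * jump (Ihp - ph) i x ^ 2) =
      bh (Jhu - uh) (Ihp - ph) -
      ((∑ i, M.fracInt i fun x => (D.α i)⁻¹ * (avg Ihp i x - S.pΓ.val x) * avg (Ihp - ph) i x) -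
      ∑ i, M.fracInt i fun x => (D.α i)⁻¹ * (avg ph i x - pΓh.val x) * avg (Ihp - ph) i x) := by
  have hq := Sh.sub_mem hI.1 hD.ph_mem
  have h1 := pressure_eq hJ hI hq
  have h2 := hD.pressure _ hq
  have h4 : ∀ i, (M.fracInt i fun x => (D.η i)⁻¹ * jump (Ihp - ph) i x ^ 2) =
      (M.fracInt i fun x => (D.η i)⁻¹ * jump Ihp i x * jump (Ihp - ph) i x) -
        M.fracInt i fun x => (D.η i)⁻¹ * jump ph i x * jump (Ihp - ph) i x := by
    intro i
    have hj := fun q => segL2_jump q i (M.γ i.castSucc) (M.γ i.succ)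
    rw [fracInt, fracInt, fracInt, ← segInt_sub (((hj _).const_mul _).mul (hj _))
      (((hj _).const_mul _).mul (hj _))]
    refine segInt_congr fun x _ => ?_
    simp only [jump_sub]
    ring
  rw [Finset.sum_congr rfl fun i _ => h4 i, Finset.sum_sub_distrib, bh_sub_left]
  linarith

/-- Young's inequality for the coupling terms on the fracture. -/
lemma fracInt_coupling_ge (S : Solution D) (Ihp ph : M.PScalar) (Rp pΓh : M.H10) (i : Fin M.nF) :
    (M.fracInt i fun x => (D.α i)⁻¹ * (avg (Ihp - ph) i x - (Rp.val x - pΓh.val x)) ^ 2) -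
      (M.fracInt i fun x => (D.α i)⁻¹ * (S.pΓ.val x - Rp.val x) ^ 2) ≤
    2 * (((M.fracInt i fun x => (D.α i)⁻¹ * (avg Ihp i x - S.pΓ.val x) * avg (Ihp - ph) i x) -
      M.fracInt i fun x => (D.α i)⁻¹ * (avg ph i x - pΓh.val x) * avg (Ihp - ph) i x) -
      ((M.fracInt i fun x => (D.α i)⁻¹ * (avg Ihp i x - S.pΓ.val x) * (Rp.val x - pΓh.val x)) -
      M.fracInt i fun x => (D.α i)⁻¹ * (avg ph i x - pΓh.val x) * (Rp.val x - pΓh.val x))) := by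
  have ha := fun q => segL2_avg q i (M.γ i.castSucc) (M.γ i.succ)
  have hv := fun q : M.H10 => q.segL2_val i
  have i1 := (((ha (Ihp - ph)).sub ((hv Rp).sub (hv pΓh))).sq).const_mul (D.α i)⁻¹
  have i2 := (((hv S.pΓ).sub (hv Rp)).sq).const_mul (D.α i)⁻¹
  have j1 := (((ha Ihp).sub (hv S.pΓ)).const_mul (D.α i)⁻¹).mul (ha (Ihp - ph))
  have j2 := (((ha ph).sub (hv pΓh)).const_mul (D.α i)⁻¹).mul (ha (Ihp - ph))
  have j3 := (((ha Ihp).sub (hv S.pΓ)).const_mul (D.α i)⁻¹).mul ((hv Rp).sub (hv pΓh))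
  have j4 := (((ha ph).sub (hv pΓh)).const_mul (D.α i)⁻¹).mul ((hv Rp).sub (hv pΓh))
  rw [fracInt, fracInt, fracInt, fracInt, fracInt, fracInt, ← segInt_sub i1 i2,
    ← segInt_sub j1 j2, ← segInt_sub j3 j4, ← segInt_sub (j1.sub j2) (j3.sub j4),
    ← segInt_const_mul]
  refine segInt_mono (i1.sub i2) (((j1.sub j2).sub (j3.sub j4)).const_mul 2) fun x => ?_
  rw [avg_sub, ← sub_nonneg]
  have hα : 0 ≤ (D.α i)⁻¹ := (inv_pos.2 (D.α_pos i)).le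
  -- With `X = {e_p} - e_Γ` and `b = p_Γ - Π p_Γ` the right-hand side is `2 α⁻¹ (X - b) X`, which
  -- exceeds `α⁻¹ (X² - b²)` by `α⁻¹ (X - b)²`.
  have := mul_nonneg hα (sq_nonneg ((avg Ihp i x - avg ph i x - (Rp.val x - pΓh.val x)) -
    (S.pΓ.val x - Rp.val x)))
  refine this.trans_eq ?_
  ring

/-- The energy estimate for the discrete errors. -/
lemma energy_le (hD : IsDiscreteSolution D k uh ph pΓh) (hJ : IsInterpJ S k Jhu)
    (hI : IsInterpI S k Ihp) (hR : IsRitz D k S.pΓ Rp) :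
    D.KinvNormSq (fun s x => vval (Jhu s) x - vval (uh s) x) +
      2 * (∑ i, M.fracInt i fun x => D.KΓ i * (Rp.der x - pΓh.der x) ^ 2) +
      2 * (∑ i, M.fracInt i fun x => (D.η i)⁻¹ * jump (Ihp - ph) i x ^ 2) +
      (∑ i, M.fracInt i fun x =>
        (D.α i)⁻¹ * (avg (Ihp - ph) i x - (Rp.val x - pΓh.val x)) ^ 2) ≤
    D.KinvNormSq (fun s x => S.u x - vval (Jhu s) x) +
      ∑ i, M.fracInt i fun x => (D.α i)⁻¹ * (S.pΓ.val x - Rp.val x) ^ 2 := by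
  have hv := Vh.sub_mem hJ.1 hD.uh_mem
  have h1 := flux_error_eq hD hJ hI
  have h2 := fracture_error_eq hD hI hR
  have h3 := pressure_error_eq hD hJ hI
  -- Adjointness rewrites the coupling of flux and pressure as `b_h(e_u, e_p)`, the same term as in
  -- the pressure error equation, so it cancels in the sum.
  rw [← bh_eq_bhStar hv hI.1, ← bh_eq_bhStar hv hD.ph_mem, ← bh_sub_right] at h1
  have h4 := Finset.sum_le_sum fun i (_ : i ∈ Finset.univ) =>
    fracInt_coupling_ge S Ihp ph Rp pΓh i
  simp only [← Finset.mul_sum, Finset.sum_sub_distrib] at h4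
  -- Twice the mixed flux term costs one of the two copies of the energy of `e_u`; the other copy is
  -- kept.
  have h5 := Finset.sum_le_sum fun s (_ : s ∈ (Finset.univ : Finset M.Tri)) =>
    D.neg_two_mul_integral_Kinv_le (s := s)
      ((M.memLp_tri S.mass.1 s).sub (memLp_vval (Jhu s) s))
      ((memLp_vval (Jhu s) s).sub (memLp_vval (uh s) s))
  simp only [Pi.sub_apply, Finset.sum_neg_distrib, ← Finset.mul_sum, Finset.sum_add_distrib] at h5
  simp only [Data.KinvNormSq] at h1 ⊢
  linarith

end Energy

end FracturedMesh

/-- Cauchy–Schwarz for four terms: the square of the sum is at most four times the sum of the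
squares, hence the constant `2 = √4`. -/
lemma sum_sqrt_le_two_mul_sqrt {a b c d r : ℝ} (ha : 0 ≤ a) (hb : 0 ≤ b) (hc : 0 ≤ c)
    (hd : 0 ≤ d) (h : a + b + c + d ≤ r) : √a + √b + √c + √d ≤ 2 * √r := by
  have hr : 0 ≤ r := by linarith
  refine abs_le_of_sq_le_sq' ?_ (by positivity) |>.2
  rw [mul_pow, Real.sq_sqrt hr]
  nlinarith [Real.sq_sqrt ha, Real.sq_sqrt hb, Real.sq_sqrt hc, Real.sq_sqrt hd,
    sq_nonneg (√a - √b), sq_nonneg (√a - √c), sq_nonneg (√a - √d), sq_nonneg (√b - √c),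
    sq_nonneg (√b - √d), sq_nonneg (√c - √d)]

end

theorem theorem3p2 (ρ_S : ℝ) (hρ : 0 < ρ_S) :
    ∃ C : ℝ, 0 < C ∧
      ∀ (M : FracturedMesh), M.StarRegular ρ_S →
      ∀ (D : M.Data) (S : FracturedMesh.Solution D) (k : ℕ)
        (uh : M.PVector) (ph : M.PScalar) (pΓh : M.H10)
        (Jhu : M.PVector) (Ihp : M.PScalar) (Rp : M.H10),
        FracturedMesh.IsDiscreteSolution D k uh ph pΓh →
        FracturedMesh.IsInterpJ S k Jhu →
        FracturedMesh.IsInterpI S k Ihp →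
        FracturedMesh.IsRitz D k S.pΓ Rp →
        √(D.KinvNormSq fun s x => vval (Jhu s) x - vval (uh s) x)
          + √(∑ i, M.fracInt i fun x => D.KΓ i * (Rp.der x - pΓh.der x) ^ 2)
          + √(∑ i, M.fracInt i fun x =>
              (D.η i)⁻¹ * (FracturedMesh.jump (Ihp - ph) i x) ^ 2)
          + √(∑ i, M.fracInt i fun x =>
              (D.α i)⁻¹ *
                (FracturedMesh.avg (Ihp - ph) i x - (Rp.val x - pΓh.val x)) ^ 2)
        ≤ C * √(D.KinvNormSq (fun s x => S.u x - vval (Jhu s) x)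
          + ∑ i, M.fracInt i fun x => (D.α i)⁻¹ * (S.pΓ.val x - Rp.val x) ^ 2) := by
  refine ⟨2, two_pos, fun M _ D S k uh ph pΓh Jhu Ihp Rp hD hJ hI hR => ?_⟩
  have h := FracturedMesh.energy_le hD hJ hI hR
  have h1 := D.KinvNormSq_nonneg fun s x => vval (Jhu s) x - vval (uh s) x
  have h2 : 0 ≤ ∑ i, M.fracInt i fun x => D.KΓ i * (Rp.der x - pΓh.der x) ^ 2 :=
    Finset.sum_nonneg fun i _ => segInt_nonneg fun x =>
      mul_nonneg (D.KΓ_pos i).le (sq_nonneg _)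
  have h3 : 0 ≤ ∑ i, M.fracInt i fun x =>
      (D.η i)⁻¹ * (FracturedMesh.jump (Ihp - ph) i x) ^ 2 :=
    Finset.sum_nonneg fun i _ => segInt_nonneg fun x =>
      mul_nonneg (inv_pos.2 (D.η_pos i)).le (sq_nonneg _)
  have h4 : 0 ≤ ∑ i, M.fracInt i fun x => (D.α i)⁻¹ *
      (FracturedMesh.avg (Ihp - ph) i x - (Rp.val x - pΓh.val x)) ^ 2 :=
    Finset.sum_nonneg fun i _ => segInt_nonneg fun x =>
      mul_nonneg (inv_pos.2 (D.α_pos i)).le (sq_nonneg _)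
  -- The energy estimate bounds the tangential and jump terms with a factor `2`; their surplus
  -- copies are discarded.
  exact sum_sqrt_le_two_mul_sqrt h1 h2 h3 h4 (by linarith)
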